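/- **Theorem.** Let $\tau_n\in\mathbb C$ ($n\in\mathbb Z_+$) be a sequence with $\tau_n=0$ for $n>K_1$, and with $\tau_{K_1}\neq 0$ unless $\tau$ vanishes identically. Let $q_1,\dots,q_M\in\mathbb C$ ($M\ge 0$) be distinct numbers with $0<|q_m|<1$, let $T_m$ be a polynomial with complex coefficients of degree exactly $K_m\ge 0$, and set $$\varkappa_n=\tau_n+\sum_{m=1}^{M}T_m(n)\,q_m^{\,n},\qquad n\in\mathbb Z_+ .$$ Suppose that $\varkappa_n=\overline{\varkappa_n}$ for all $n$. (Then $\tau_n$ is real, the terms with non-real $q_m$ occur in complex conjugate pairs, and $T_m$ has real coefficients if $q_m$ is real.) Let $\varkappa^{(0)}_n=2/(n+1)$ for even $n$ and $\varkappa^{(0)}_n=0$ for odd $n$ (the matrix elements of the Carleman operator). Then there is a bounded self-adjoint operator $G$ on $\ell^2(\mathbb Z_+)$ (necessarily unique) with matrix elements $\varkappa^{(0)}_{n+m}+\varkappa_{n+m}$, $n,m\in\mathbb Z_+$. The part of its spectrum in $(-\infty,0)$ consists of finitely many eigenvalues of finite multiplicity, and their total number $N_-(G)$, counted with multiplicity,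 is $$N_-(G)=\nu(\tau)+\sum_{m:\ \operatorname{Im}q_m=0}\mathcal N_-(K_m,\mathsf p_m)+\sum_{m:\ \operatorname{Im}q_m>0}(K_m+1).$$ Here $\mathsf p_m=T_m^{(K_m)}$ is the (constant) $K_m$-th derivative of $T_m$; $\nu(\tau)=0$ if $\tau\equiv0$ and $\nu(\tau)=\mathcal N_-(K_1,\tau_{K_1})$ otherwise; and for an integer $K\ge0$ and real $p\ne0$, $$\mathcal N_-(K,p)=\begin{cases}(K+1)/2,& K\text{ odd},\\ K/2,& K\text{ even},\ p>0,\\ K/2+1,& K\text{ even},\ p<0.\end{cases}$$ -/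

import Mathlib

open Polynomial

/-- The complex Hilbert space `ℓ²(ℤ₊)`. -/
abbrev EllTwo : Type := lp (fun _ : ℕ => ℂ) 2

/-- The bounded operator `G` on `ℓ²(ℤ₊)` is the Hankel operator with matrix elements `a (n + m)`:
`⟨G e_m, e_n⟩ = (G e_m)_n = a (n + m)`, where `(e_m)` is the standard basis. These entries
determine a bounded operator uniquely. -/
def IsHankel (a : ℕ → ℂ) (G : EllTwo →L[ℂ] EllTwo) : Prop :=
  ∀ n m : ℕ, (G (lp.single 2 m (1 : ℂ)) : ℕ → ℂ) n = a (n + m)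

/-- Matrix elements of the Carleman operator: `2 / (n + 1)` for even `n` and `0` for odd `n`. -/
noncomputable def carlemanSeq (n : ℕ) : ℂ := if Even n then 2 / ((n : ℂ) + 1) else 0

/-- The sequence `τ_n + ∑_m T_m(n) q_m ^ n`. -/
noncomputable def expPolySeq {M : ℕ} (τ : ℕ → ℂ) (T : Fin M → ℂ[X]) (q : Fin M → ℂ)
    (n : ℕ) : ℂ :=
  τ n + ∑ m, (T m).eval (n : ℂ) * q m ^ n

/-- The number `𝒩₋` of a real term of degree `K` with leading sign given by `p` (which is
nonzero wherever this is used): `(K + 1) / 2` for odd `K`; `K / 2` for even `K` and `p > 0`;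
`K / 2 + 1` for even `K` and `p < 0`. The divisions are exact. -/
noncomputable def negCount (K : ℕ) (p : ℝ) : ℕ :=
  if Odd K then (K + 1) / 2 else if 0 < p then K / 2 else K / 2 + 1

/-- `N₋(A) = N` for a (self-adjoint) bounded operator `A` and a finite number `N`: the part of the
spectrum of `A` in `(-∞, 0)` is a finite set of eigenvalues of finite multiplicity, and the sum of
their multiplicities is `N`. -/
def NegativeMultiplicityEq (A : EllTwo →L[ℂ] EllTwo) (N : ℕ) : Prop :=
  ∃ s : Finset ℝ, (s : Set ℝ) = spectrum ℝ A ∩ Set.Iio 0 ∧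
    (∀ x ∈ s, Module.End.HasEigenvalue (A : EllTwo →ₗ[ℂ] EllTwo) (x : ℂ) ∧
      FiniteDimensional ℂ (Module.End.eigenspace (A : EllTwo →ₗ[ℂ] EllTwo) (x : ℂ))) ∧
    ∑ x ∈ s, Module.finrank ℂ (Module.End.eigenspace (A : EllTwo →ₗ[ℂ] EllTwo) (x : ℂ)) = N

/-- The number `p_m = T_m^{(K_m)}`, the `K`-th derivative of a polynomial of degree `K`. It is a
constant, and it is real for the terms for which it is used, so that its real part is taken. -/
noncomputable def topDerivative (T : ℂ[X]) (K : ℕ) : ℝ := ((derivative^[K] T).eval 0).re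

open Classical in
/-- The total number predicted for `N₋`: the terms with real `q_m` (and the term `τ`, unless it
vanishes identically) contribute `𝒩₋`, and each pair of complex conjugate terms, listed by the one
with `Im q_m > 0`, contributes `K_m + 1`. -/
noncomputable def totalNegCount {M : ℕ} (τ : ℕ → ℂ) (K₁ : ℕ) (T : Fin M → ℂ[X])
    (K : Fin M → ℕ) (q : Fin M → ℂ) : ℕ :=
  (if τ = 0 then 0 else negCount K₁ (τ K₁).re)
    + ∑ m with (q m).im = 0, negCount (K m) (topDerivative (T m) (K m))
    + ∑ m with 0 < (q m).im, K m
    + Finset.card {m : Fin M | 0 < (q m).im}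

/-! A finitely supported sequence is the coefficient vector of a polynomial `p`, and the form of a
Hankel operator at `p` is the linear functional with the given moments applied to `p * conjPoly p`.
The Carleman sequence consists of the moments of Lebesgue measure on (-1, 1), so it contributes the
energy ∫|p|². The sequence T_m(n) q_m^n gives a functional of the jet of order K_m at q_m, and τ
gives one at 0. The perturbing form therefore lives on polynomials modulo a fixed `modulus`, and its
negative index is a sum over real points and conjugate pairs.

Upper bound: require `p` to vanish to order `negExponent j` at each point. Then `p * conjPoly p`
kills every jet functional, apart from a nonnegative middle term at some real points, while the
energy is nonnegative anyway. This costs exactly N conditions.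

Lower bound: the positive energy must not destroy negative squares. The perturbing form does not see
multiples of `modulus`, and these are dense in L²(-1, 1), because a nonzero polynomial has finitely
many zeros. Hence each residue class has representatives of arbitrarily small energy. An
N-dimensional space where the perturbing form is ≤ 0 is tilted along a dual family to make the form
strictly negative, and then corrected by multiples of `modulus`.

Glazman's lemma turns the two bounds into the rank of A⁻, which equals the number of negative
eigenvalues counted with multiplicity. Boundedness of G is Hilbert's inequality. -/

/-! ### Negative spectrum and the rank of the negative part -/

section Spectral

open Module.End CFC
open scoped ComplexInnerProductSpace

variable {H : Type*} [NormedAddCommGroup H] [InnerProductSpace ℂ H] [CompleteSpace H]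

omit [CompleteSpace H] in
theorem isCompactOperator_of_finiteDimensional_range (B : H →L[ℂ] H)
    (hB : FiniteDimensional ℂ (LinearMap.range (B : H →ₗ[ℂ] H))) : IsCompactOperator B := by
  have : LocallyCompactSpace (LinearMap.range (B : H →ₗ[ℂ] H)) :=
    have := FiniteDimensional.proper ℂ (LinearMap.range (B : H →ₗ[ℂ] H))
    inferInstance
  have h : IsCompactOperator (B.codRestrict (LinearMap.range (B : H →ₗ[ℂ] H)) fun x => ⟨x, rfl⟩) :=
    isCompactOperator_of_locallyCompactSpace_dom
      (B.codRestrict (LinearMap.range (B : H →ₗ[ℂ] H)) fun x => ⟨x, rfl⟩)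
  exact h.clm_comp (Submodule.subtypeL _)

/-- The range of the negative part of a bounded operator. -/
noncomputable def negRange (A : H →L[ℂ] H) : Submodule ℂ H :=
  LinearMap.range ((A⁻ : H →L[ℂ] H) : H →ₗ[ℂ] H)

theorem isPositive_posPart (A : H →L[ℂ] H) : (A⁺).IsPositive :=
  (ContinuousLinearMap.nonneg_iff_isPositive _).1 (posPart_nonneg A)

theorem isPositive_negPart (A : H →L[ℂ] H) : (A⁻).IsPositive :=
  (ContinuousLinearMap.nonneg_iff_isPositive _).1 (negPart_nonneg A)

theorem apply_eq_posPart_sub_negPart {A : H →L[ℂ] H} (hA : IsSelfAdjoint A) (x : H) :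
    A x = A⁺ x - A⁻ x := by
  conv_lhs => rw [← posPart_sub_negPart A hA]
  rfl

theorem posPart_negPart_apply (A : H →L[ℂ] H) (x : H) : A⁺ (A⁻ x) = 0 := by
  exact congrArg (fun B : H →L[ℂ] H => B x) (posPart_mul_negPart A)

theorem ContinuousLinearMap.IsPositive.apply_eq_zero {B : H →L[ℂ] H} (hB : B.IsPositive) {x : H}
    (hx : (⟪B x, x⟫).re ≤ 0) : B x = 0 := by
  have hB' : 0 ≤ B := (ContinuousLinearMap.nonneg_iff_isPositive _).2 hB
  obtain ⟨S, hS, hSS⟩ : ∃ S : H →L[ℂ] H, IsSelfAdjoint S ∧ S * S = B :=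
    ⟨CFC.sqrt B, (CFC.sqrt_nonneg B).isSelfAdjoint, CFC.sqrt_mul_sqrt_self B⟩
  have h1 : ⟪B x, x⟫ = ⟪S x, S x⟫ := by
    rw [← hSS]
    exact hS.isSymmetric (S x) x
  have h2 : S x = 0 := by
    rw [h1] at hx
    rw [← norm_eq_zero]
    have := inner_self_eq_norm_sq (𝕜 := ℂ) (S x)
    simp only [RCLike.re_to_complex] at this
    nlinarith [norm_nonneg (S x)]
  rw [← hSS]
  simp [h2]

/-- Since A⁺A⁻ = 0, an eigenvector x of A for t satisfies A⁺A⁺x = tA⁺x. Pairing with x gives t⟨A⁺x,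
x⟩ = ‖A⁺x‖², so t < 0 forces A⁺x = 0. -/
theorem apply_eq_smul_iff_negPart {A : H →L[ℂ] H} (hA : IsSelfAdjoint A) {t : ℝ} (ht : t < 0)
    {x : H} : A x = (t : ℂ) • x ↔ A⁻ x = (-t : ℂ) • x := by
  have htc : (t : ℂ) ≠ 0 := by exact_mod_cast ht.ne
  constructor
  · intro h
    have h1 : A⁺ x = 0 := by
      apply (isPositive_posPart A).apply_eq_zero
      have h2 : A⁺ (A⁺ x) = (t : ℂ) • A⁺ x := by
        rw [← map_smul, ← h, apply_eq_posPart_sub_negPart hA x, map_sub, posPart_negPart_apply,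
          sub_zero]
      have h3 : ⟪A⁺ (A⁺ x), x⟫ = ⟪A⁺ x, A⁺ x⟫ := (isPositive_posPart A).isSelfAdjoint.isSymmetric _ _
      rw [h2, inner_smul_left, Complex.conj_ofReal] at h3
      have h4 := congrArg Complex.re h3
      have h5 := inner_self_nonneg (𝕜 := ℂ) (x := A⁺ x)
      simp only [Complex.re_ofReal_mul, RCLike.re_to_complex] at h4 h5
      nlinarith
    have h2 := apply_eq_posPart_sub_negPart hA x
    rw [h1, h, zero_sub] at h2
    rw [neg_smul, h2, neg_neg]
  · intro h
    have h1 : A⁺ x = 0 := by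
      have h2 := posPart_negPart_apply A x
      rw [h, map_smul] at h2
      exact (smul_eq_zero.1 h2).resolve_left (neg_ne_zero.2 htc)
    rw [apply_eq_posPart_sub_negPart hA, h1, h]
    simp

/-- For t < 0 the operator S = A⁺ - t is invertible and A - t = S(1 - S⁻¹A⁻) with S⁻¹A⁻ of finite
rank, so the Fredholm alternative applies. -/
theorem exists_eigenvector_of_mem_spectrum {A : H →L[ℂ] H} (hA : IsSelfAdjoint A)
    (hB : FiniteDimensional ℂ (negRange A)) {t : ℝ} (ht : t < 0)
    (hs : t ∈ spectrum ℝ A) : ∃ x ≠ 0, A x = (t : ℂ) • x := by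
  have hu : IsUnit (A⁺ - algebraMap ℝ (H →L[ℂ] H) t) := by
    by_contra h
    have : t ∈ spectrum ℝ A⁺ := by
      rw [spectrum.mem_iff, ← IsUnit.neg_iff, neg_sub]
      exact h
    exact ht.not_ge (spectrum_nonneg_of_nonneg (posPart_nonneg A) this)
  obtain ⟨S, hS⟩ := hu
  have hc : IsCompactOperator (↑S⁻¹ * A⁻ : H →L[ℂ] H) :=
    (isCompactOperator_of_finiteDimensional_range A⁻ hB).clm_comp (↑S⁻¹ : H →L[ℂ] H)
  have hfac : A - algebraMap ℝ (H →L[ℂ] H) t = S * (1 - ↑S⁻¹ * A⁻) := by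
    rw [mul_sub, mul_one, ← mul_assoc, Units.mul_inv, one_mul, hS]
    conv_lhs => rw [← posPart_sub_negPart A hA]
    abel
  rcases hc.hasEigenvalue_or_mem_resolventSet one_ne_zero with h | h
  · obtain ⟨x, hx⟩ := h.exists_hasEigenvector
    refine ⟨x, hx.2, ?_⟩
    have h1 : (1 - ↑S⁻¹ * A⁻ : H →L[ℂ] H) x = 0 := by
      have := hx.apply_eq_smul
      simp only [one_smul] at this
      rw [sub_apply, one_apply_eq_self]
      exact sub_eq_zero.2 this.symm
    have h2 : A x - (algebraMap ℝ (H →L[ℂ] H) t) x = S.val ((1 - ↑S⁻¹ * A⁻ : H →L[ℂ] H) x) :=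
      congrArg (fun B : H →L[ℂ] H => B x) hfac
    rw [h1, map_zero, sub_eq_zero] at h2
    rw [h2, Algebra.algebraMap_eq_smul_one]
    simp
  · exfalso
    rw [spectrum.mem_resolventSet_iff, map_one] at h
    rw [spectrum.mem_iff, ← IsUnit.neg_iff, neg_sub, hfac] at hs
    exact hs (S.isUnit.mul h)

theorem negPart_apply_ne_zero {A : H →L[ℂ] H} (hA : IsSelfAdjoint A) {x : H}
    (hx : (⟪A x, x⟫).re < 0) : A⁻ x ≠ 0 := by
  intro h
  rw [apply_eq_posPart_sub_negPart hA, h, sub_zero] at hx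
  exact hx.not_ge ((isPositive_posPart A).re_inner_nonneg_left x)

theorem eq_zero_of_mem_negRange {A : H →L[ℂ] H} (hA : IsSelfAdjoint A) {x : H}
    (hx : x ∈ negRange A) (h0 : 0 ≤ (⟪A x, x⟫).re) : x = 0 := by
  obtain ⟨y, rfl⟩ := hx
  change A⁻ y = 0
  change 0 ≤ (⟪A (A⁻ y), A⁻ y⟫).re at h0
  rw [apply_eq_posPart_sub_negPart hA, posPart_negPart_apply, zero_sub, inner_neg_left,
    Complex.neg_re] at h0
  have h1 : A⁻ (A⁻ y) = 0 := (isPositive_negPart A).apply_eq_zero (by linarith)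
  have h2 : ⟪A⁻ (A⁻ y), y⟫ = ⟪A⁻ y, A⁻ y⟫ := (isPositive_negPart A).isSelfAdjoint.isSymmetric _ _
  rw [h1, inner_zero_left] at h2
  exact inner_self_eq_zero.1 h2.symm

/-- If the form of `A` is nonnegative on `W` and `W + F` is dense, the range of the negative part
of `A` has dimension at most `dim F`. -/
theorem finrank_negRange_le {A : H →L[ℂ] H} (hA : IsSelfAdjoint A) (W F : Submodule ℂ H)
    [FiniteDimensional ℂ F] (hWF : (W ⊔ F).topologicalClosure = ⊤)
    (hW : ∀ x ∈ W, 0 ≤ (⟪A x, x⟫).re) :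
    FiniteDimensional ℂ (negRange A) ∧
      Module.finrank ℂ (negRange A) ≤ Module.finrank ℂ F := by
  set R := negRange A
  set V := W.topologicalClosure
  have hV : ∀ x ∈ V, 0 ≤ (⟪A x, x⟫).re := by
    intro x hx
    have hcl : IsClosed {x : H | 0 ≤ (⟪A x, x⟫).re} := isClosed_le continuous_const (by fun_prop)
    exact closure_minimal (fun y hy => hW y hy) hcl hx
  -- A closed subspace plus a finite-dimensional one is closed, so density becomes equality, and H/V
  -- is a quotient of F.
  have htop : V ⊔ F = ⊤ := by
    have hcl := Submodule.isClosed_sup_finiteDimensional V F W.isClosed_topologicalClosure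
    rw [eq_top_iff, ← hWF]
    exact Submodule.topologicalClosure_minimal _ (sup_le_sup_right W.le_topologicalClosure _) hcl
  let f : F →ₗ[ℂ] H ⧸ V := V.mkQ ∘ₗ F.subtype
  have hf : Function.Surjective f := by
    intro z
    obtain ⟨x, rfl⟩ := V.mkQ_surjective z
    obtain ⟨v, hv, w, hw, rfl⟩ := Submodule.mem_sup.1 (htop ▸ Submodule.mem_top : x ∈ V ⊔ F)
    refine ⟨⟨w, hw⟩, ?_⟩
    simp only [f, LinearMap.comp_apply, Submodule.subtype_apply, map_add]
    rw [(Submodule.Quotient.mk_eq_zero V).2 hv |> fun h => (h : V.mkQ v = 0), zero_add]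
  have : FiniteDimensional ℂ (H ⧸ V) := Module.Finite.of_surjective f hf
  let g : R →ₗ[ℂ] H ⧸ V := V.mkQ ∘ₗ R.subtype
  -- On the range of A⁻ the form is strictly negative off zero, so this range meets V trivially.
  have hg : Function.Injective g := by
    rw [← LinearMap.ker_eq_bot, LinearMap.ker_eq_bot']
    rintro ⟨x, hx⟩ h
    have hxV : x ∈ V := (Submodule.Quotient.mk_eq_zero V).1 h
    exact Subtype.ext (eq_zero_of_mem_negRange hA hx (hV x hxV))
  exact ⟨Module.Finite.of_injective g hg, (LinearMap.finrank_le_finrank_of_injective hg).trans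
    (LinearMap.finrank_le_finrank_of_surjective hf)⟩


/-- The range of A⁻ is invariant and contains every eigenvector of A with negative eigenvalue. The
restriction of A to it is symmetric with only negative eigenvalues, and finite-dimensional
diagonalization counts them. -/
theorem exists_finset_eigenvalues_finrank_negRange {A : H →L[ℂ] H}
    (hA : IsSelfAdjoint A)
    (hB : FiniteDimensional ℂ (negRange A)) :
    ∃ s : Finset ℝ, (s : Set ℝ) = spectrum ℝ A ∩ Set.Iio 0 ∧
      (∀ x ∈ s, HasEigenvalue (A : H →ₗ[ℂ] H) (x : ℂ) ∧
        FiniteDimensional ℂ (eigenspace (A : H →ₗ[ℂ] H) (x : ℂ))) ∧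
      ∑ x ∈ s, Module.finrank ℂ (eigenspace (A : H →ₗ[ℂ] H) (x : ℂ)) =
        Module.finrank ℂ (negRange A) := by
  set R := negRange A with hR
  have hinv : ∀ x ∈ R, (A : H →ₗ[ℂ] H) x ∈ R := by
    rintro _ ⟨y, rfl⟩
    refine ⟨-(A⁻ y), ?_⟩
    change A⁻ (-(A⁻ y)) = A (A⁻ y)
    rw [apply_eq_posPart_sub_negPart hA, posPart_negPart_apply]
    simp
  have hAs : (A : H →ₗ[ℂ] H).IsSymmetric := hA.isSymmetric
  let T : R →ₗ[ℂ] R := (A : H →ₗ[ℂ] H).restrict hinv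
  have hT : T.IsSymmetric := hAs.restrict_invariant hinv
  have hmemR : ∀ (t : ℝ) (x : H), t < 0 → A x = (t : ℂ) • x → x ∈ R := by
    intro t x ht hx
    have h := (apply_eq_smul_iff_negPart hA ht).1 hx
    have htc : (-t : ℂ) ≠ 0 := neg_ne_zero.2 (by exact_mod_cast ht.ne)
    refine ⟨(-t : ℂ)⁻¹ • x, ?_⟩
    change A⁻ _ = x
    rw [map_smul, h, smul_smul, inv_mul_cancel₀ htc, one_smul]
  have hneg : ∀ μ : Eigenvalues T, ((μ : ℂ).re : ℂ) = μ ∧ (μ : ℂ).re < 0 := by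
    intro μ
    have hre : ((μ : ℂ).re : ℂ) = μ := Complex.conj_eq_iff_re.1 (hT.conj_eigenvalue_eq_self μ.2)
    refine ⟨hre, ?_⟩
    by_contra! h
    obtain ⟨x, hx⟩ := (show HasEigenvalue T μ from μ.2).exists_hasEigenvector
    have h1 : A (x : H) = (μ : ℂ) • (x : H) := congrArg Subtype.val hx.apply_eq_smul
    refine hx.2 (Subtype.ext (eq_zero_of_mem_negRange hA x.2 ?_))
    rw [h1, ← hre, inner_smul_left, Complex.conj_ofReal, Complex.re_ofReal_mul]
    exact mul_nonneg h (inner_self_nonneg (𝕜 := ℂ) (x := (x : H)))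
  have hequiv : ∀ t : ℝ, t < 0 → Nonempty (eigenspace T (t : ℂ) ≃ₗ[ℂ]
      eigenspace (A : H →ₗ[ℂ] H) (t : ℂ)) := by
    intro t ht
    refine ⟨LinearEquiv.ofBijective ((R.subtype ∘ₗ (eigenspace T (t : ℂ)).subtype).codRestrict _
      fun x => ?_) ⟨fun x y h => ?_, fun x => ?_⟩⟩
    · rw [mem_eigenspace_iff]
      exact congrArg Subtype.val (mem_eigenspace_iff.1 x.2)
    · have h' := congrArg (fun z : eigenspace (A : H →ₗ[ℂ] H) (t : ℂ) => (z : H)) h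
      exact Subtype.ext (Subtype.ext h')
    · have hx := mem_eigenspace_iff.1 x.2
      exact ⟨⟨⟨x, hmemR t x ht hx⟩, mem_eigenspace_iff.2 (Subtype.ext hx)⟩, rfl⟩
  classical
  have hfr : ∀ t : ℝ, t < 0 → Module.finrank ℂ (eigenspace T (t : ℂ)) =
      Module.finrank ℂ (eigenspace (A : H →ₗ[ℂ] H) (t : ℂ)) :=
    fun t ht => (hequiv t ht).some.finrank_eq
  have : Fintype (Eigenvalues T) := Fintype.ofFinite _
  have hinj : Function.Injective fun μ : Eigenvalues T => (μ : ℂ).re := by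
    intro μ ν h
    apply Subtype.ext
    change (μ : ℂ) = ν
    rw [← (hneg μ).1, ← (hneg ν).1]
    exact congrArg _ h
  have hev : ∀ x ∈ (Finset.univ : Finset (Eigenvalues T)).image
      (fun μ : Eigenvalues T => (μ : ℂ).re),
      x < 0 ∧ HasEigenvalue (A : H →ₗ[ℂ] H) (x : ℂ) := by
    intro x hx
    obtain ⟨μ, -, rfl⟩ := Finset.mem_image.1 hx
    refine ⟨(hneg μ).2, ?_⟩
    rw [(hneg μ).1]
    obtain ⟨x, hx⟩ := (show HasEigenvalue T μ from μ.2).exists_hasEigenvector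
    refine hasEigenvalue_of_hasEigenvector (x := (x : H)) ⟨mem_eigenspace_iff.2
      (congrArg Subtype.val hx.apply_eq_smul), fun h => hx.2 (Subtype.ext h)⟩
  refine ⟨(Finset.univ : Finset (Eigenvalues T)).image fun μ : Eigenvalues T => (μ : ℂ).re,
    ?_, ?_, ?_⟩
  · ext t
    constructor
    · intro ht
      obtain ⟨h1, h2⟩ := hev t ht
      refine ⟨?_, h1⟩
      rw [spectrum.mem_iff]
      intro hu
      obtain ⟨x, hx⟩ := h2.exists_hasEigenvector
      have h3 := ContinuousLinearMap.isUnit_iff_bijective.1 hu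
      refine hx.2 (h3.1 ?_)
      have h4 : A x = (t : ℂ) • x := hx.apply_eq_smul
      rw [map_zero, sub_apply, h4, Algebra.algebraMap_eq_smul_one]
      exact sub_eq_zero.2 (RCLike.real_smul_eq_coe_smul (K := ℂ) t x)
    · rintro ⟨h1, h2⟩
      obtain ⟨x, hx0, hx⟩ := exists_eigenvector_of_mem_spectrum hA hB h2 h1
      have : HasEigenvalue T (t : ℂ) := hasEigenvalue_of_hasEigenvector
        (x := ⟨x, hmemR t x h2 hx⟩) ⟨mem_eigenspace_iff.2 (Subtype.ext hx),
          fun h => hx0 (congrArg Subtype.val h)⟩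
      exact Finset.mem_coe.2 (Finset.mem_image.2 ⟨⟨(t : ℂ), this⟩, Finset.mem_univ _,
        Complex.ofReal_re t⟩)
  · intro x hx
    obtain ⟨h1, h2⟩ := hev x hx
    exact ⟨h2, Module.Finite.equiv (hequiv x h1).some⟩
  · rw [Finset.sum_image fun _ _ _ _ h => hinj h]
    have hint := hT.direct_sum_isInternal
    rw [← (LinearEquiv.ofBijective (DirectSum.coeLinearMap _) hint).finrank_eq,
      Module.finrank_directSum]
    refine Finset.sum_congr rfl fun μ _ => ?_
    rw [← hfr _ (hneg μ).2, (hneg μ).1]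

/-- Glazman's lemma, for the rank of the negative part. -/
theorem finrank_negRange_eq {A : H →L[ℂ] H} (hA : IsSelfAdjoint A) {N : ℕ}
    (W F : Submodule ℂ H) [FiniteDimensional ℂ F] (hF : Module.finrank ℂ F ≤ N)
    (hWF : (W ⊔ F).topologicalClosure = ⊤) (hW : ∀ x ∈ W, 0 ≤ (⟪A x, x⟫).re)
    (f : (Fin N → ℂ) →ₗ[ℂ] H) (hf : ∀ c, c ≠ 0 → (⟪A (f c), f c⟫).re < 0) :
    FiniteDimensional ℂ (negRange A) ∧ Module.finrank ℂ (negRange A) = N := by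
  obtain ⟨hB, hle⟩ := finrank_negRange_le hA W F hWF hW
  have hinj : Function.Injective (((A⁻ : H →L[ℂ] H) : H →ₗ[ℂ] H).rangeRestrict ∘ₗ f) := by
    rw [← LinearMap.ker_eq_bot, LinearMap.ker_eq_bot']
    intro c hc
    by_contra h
    exact negPart_apply_ne_zero hA (hf c h) (congrArg Subtype.val hc)
  have : FiniteDimensional ℂ (LinearMap.range ((A⁻ : H →L[ℂ] H) : H →ₗ[ℂ] H)) := hB
  have hge := LinearMap.finrank_le_finrank_of_injective hinj
  rw [Module.finrank_fin_fun] at hge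
  exact ⟨hB, le_antisymm (hle.trans hF) hge⟩

end Spectral

open scoped ComplexInnerProductSpace in
/-- Glazman's lemma: a subspace of codimension at most `N` (up to closure) where the form is
nonnegative, and an `N`-dimensional one where it is negative. -/
theorem negativeMultiplicityEq_of_form {A : EllTwo →L[ℂ] EllTwo} (hA : IsSelfAdjoint A) {N : ℕ}
    (W F : Submodule ℂ EllTwo) [FiniteDimensional ℂ F] (hF : Module.finrank ℂ F ≤ N)
    (hWF : (W ⊔ F).topologicalClosure = ⊤) (hW : ∀ x ∈ W, 0 ≤ (⟪A x, x⟫).re)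
    (f : (Fin N → ℂ) →ₗ[ℂ] EllTwo) (hf : ∀ c, c ≠ 0 → (⟪A (f c), f c⟫).re < 0) :
    NegativeMultiplicityEq A N := by
  obtain ⟨hB, hN⟩ := finrank_negRange_eq hA W F hF hWF hW f hf
  have h := exists_finset_eigenvalues_finrank_negRange hA hB
  rwa [hN] at h

/-! ### Hilbert's inequality -/

section Schur

/-- The bound for the head of the sum: replace 1/(n+m+1) by 1/(n+1) and telescope 1/√(m+1) ≤
2(√(m+1) - √m). -/
theorem sum_range_inv_mul_inv_sqrt_le (n N : ℕ) :
    ∑ m ∈ Finset.range N, ((n : ℝ) + m + 1)⁻¹ * (√((m : ℝ) + 1))⁻¹ ≤ 2 * √N / (n + 1) := by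
  induction N with
  | zero => simp
  | succ N ih =>
    rw [Finset.sum_range_succ]
    refine (add_le_add_left ih _).trans ?_
    have hn : (0 : ℝ) < n + 1 := by positivity
    have hy : 0 < √((N : ℝ) + 1) := by positivity
    have hx : 0 ≤ √(N : ℝ) := Real.sqrt_nonneg _
    have hxy : √(N : ℝ) ≤ √((N : ℝ) + 1) := Real.sqrt_le_sqrt (by linarith)
    have hx2 : √(N : ℝ) ^ 2 = N := Real.sq_sqrt (by positivity)
    have hy2 : √((N : ℝ) + 1) ^ 2 = N + 1 := Real.sq_sqrt (by positivity)
    have h1 : (√((N : ℝ) + 1))⁻¹ ≤ 2 * (√((N : ℝ) + 1) - √N) := by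
      rw [inv_le_iff_one_le_mul₀ hy]
      nlinarith
    have h2 : ((n : ℝ) + N + 1)⁻¹ ≤ ((n : ℝ) + 1)⁻¹ := by
      gcongr
      linarith [(Nat.cast_nonneg N : (0 : ℝ) ≤ N)]
    have h3 : ((n : ℝ) + N + 1)⁻¹ * (√((N : ℝ) + 1))⁻¹ ≤
        ((n : ℝ) + 1)⁻¹ * (2 * (√((N : ℝ) + 1) - √N)) := by
      gcongr
    push_cast
    refine (add_le_add_right h3 _).trans (le_of_eq ?_)
    field_simp
    ring

/-- Past m = n, replace 1/(n+m+1) by 1/(m+1) and telescope (m+1)^(-3/2) ≤ 2(1/√m - 1/√(m+1)). The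
head, m ≤ n, contributes 2/√(n+1). -/
theorem sum_range_inv_mul_inv_sqrt_le_of_le (n N : ℕ) (h : n + 1 ≤ N) :
    ∑ m ∈ Finset.range N, ((n : ℝ) + m + 1)⁻¹ * (√((m : ℝ) + 1))⁻¹ ≤
      4 * (√((n : ℝ) + 1))⁻¹ - 2 * (√N)⁻¹ := by
  induction N, h using Nat.le_induction with
  | base =>
    refine (sum_range_inv_mul_inv_sqrt_le n (n + 1)).trans (le_of_eq ?_)
    push_cast
    have hn : (0 : ℝ) < n + 1 := by positivity
    have hy : 0 < √((n : ℝ) + 1) := by positivity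
    have hy2 : √((n : ℝ) + 1) ^ 2 = n + 1 := Real.sq_sqrt (by positivity)
    have h : 2 * √((n : ℝ) + 1) / (n + 1) = 2 * (√((n : ℝ) + 1))⁻¹ := by
      nth_rewrite 2 [← hy2]
      field_simp
    rw [h]
    ring
  | succ N hN ih =>
    rw [Finset.sum_range_succ]
    refine (add_le_add_left ih _).trans ?_
    have hN0 : (0 : ℝ) < N := by exact_mod_cast (by omega : 0 < N)
    have hy : 0 < √((N : ℝ) + 1) := by positivity
    have hx : 0 < √(N : ℝ) := by positivity
    have hxy : √(N : ℝ) ≤ √((N : ℝ) + 1) := Real.sqrt_le_sqrt (by linarith)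
    have hx2 : √(N : ℝ) ^ 2 = N := Real.sq_sqrt (by positivity)
    have hy2 : √((N : ℝ) + 1) ^ 2 = N + 1 := Real.sq_sqrt (by positivity)
    have h2 : ((n : ℝ) + N + 1)⁻¹ ≤ (√((N : ℝ) + 1) ^ 2)⁻¹ := by
      rw [hy2]
      gcongr
      linarith [(Nat.cast_nonneg n : (0 : ℝ) ≤ n)]
    push_cast
    set x := √(N : ℝ)
    set y := √((N : ℝ) + 1)
    have h3 : ((n : ℝ) + N + 1)⁻¹ * y⁻¹ ≤ (y ^ 2)⁻¹ * y⁻¹ := by gcongr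
    have h4 : (y ^ 2)⁻¹ * y⁻¹ ≤ 2 * x⁻¹ - 2 * y⁻¹ := by
      have : 2 * x⁻¹ - 2 * y⁻¹ - (y ^ 2)⁻¹ * y⁻¹ = (2 * y ^ 2 * (y - x) - x) / (x * y ^ 3) := by
        field_simp
      have h5 : 0 ≤ 2 * y ^ 2 * (y - x) - x := by
        have : 1 ≤ 2 * y * (y - x) := by nlinarith
        nlinarith
      have : 0 ≤ (2 * y ^ 2 * (y - x) - x) / (x * y ^ 3) := by positivity
      linarith
    linarith

theorem sum_inv_mul_inv_sqrt_le (n : ℕ) (s : Finset ℕ) :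
    ∑ m ∈ s, ((n : ℝ) + m + 1)⁻¹ * (√((m : ℝ) + 1))⁻¹ ≤ 4 * (√((n : ℝ) + 1))⁻¹ := by
  obtain ⟨N, hN⟩ := s.exists_nat_subset_range
  have h1 : s ⊆ Finset.range (N + n + 1) := hN.trans (Finset.range_mono (by omega))
  refine (Finset.sum_le_sum_of_subset_of_nonneg h1 fun _ _ _ => by positivity).trans ?_
  refine (sum_range_inv_mul_inv_sqrt_le_of_le n (N + n + 1) (by omega)).trans ?_
  have : 0 ≤ (√((N + n + 1 : ℕ) : ℝ))⁻¹ := by positivity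
  linarith

/-- Hilbert's inequality by the Schur test. -/
theorem sum_sq_sum_inv_mul_le (x : ℕ → ℝ) (s t : Finset ℕ) :
    ∑ n ∈ s, (∑ m ∈ t, ((n : ℝ) + m + 1)⁻¹ * x m) ^ 2 ≤ 16 * ∑ m ∈ t, x m ^ 2 := by
  have h1 : ∀ n ∈ s, (∑ m ∈ t, ((n : ℝ) + m + 1)⁻¹ * x m) ^ 2 ≤
      4 * ∑ m ∈ t, (((m : ℝ) + n + 1)⁻¹ * (√((n : ℝ) + 1))⁻¹) * (x m ^ 2 * √((m : ℝ) + 1)) := by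
    intro n _
    -- Cauchy–Schwarz with the Schur weight 1/√(m+1).
    refine (Finset.sum_sq_le_sum_mul_sum_of_sq_le_mul t
      (f := fun m : ℕ => ((n : ℝ) + m + 1)⁻¹ * (√((m : ℝ) + 1))⁻¹)
      (g := fun m : ℕ => ((n : ℝ) + m + 1)⁻¹ * (x m ^ 2 * √((m : ℝ) + 1)))
      (fun m _ => by positivity) (fun m _ => by positivity) fun m _ => ?_).trans ?_
    · have : 0 < √((m : ℝ) + 1) := by positivity
      refine le_of_eq ?_
      field_simp
    · refine (mul_le_mul_of_nonneg_right (sum_inv_mul_inv_sqrt_le n t)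
        (Finset.sum_nonneg fun m _ => by positivity)).trans (le_of_eq ?_)
      rw [mul_assoc, Finset.mul_sum]
      congr 1
      refine Finset.sum_congr rfl fun m _ => ?_
      rw [add_comm (m : ℝ)]
      ring
  refine (Finset.sum_le_sum h1).trans ?_
  rw [← Finset.mul_sum, Finset.sum_comm, (by norm_num : (16 : ℝ) = 4 * 4), mul_assoc]
  refine mul_le_mul_of_nonneg_left ?_ (by norm_num)
  rw [Finset.mul_sum]
  refine Finset.sum_le_sum fun m _ => ?_
  rw [← Finset.sum_mul]
  refine (mul_le_mul_of_nonneg_right (sum_inv_mul_inv_sqrt_le m s) (by positivity)).trans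
    (le_of_eq ?_)
  have : 0 < √((m : ℝ) + 1) := by positivity
  field_simp

end Schur

/-! ### Hankel operators and their forms on polynomials -/

section HankelOperator

theorem EllTwo.sum_norm_sq_le (u : EllTwo) (t : Finset ℕ) : ∑ m ∈ t, ‖u m‖ ^ 2 ≤ ‖u‖ ^ 2 := by
  have := lp.sum_rpow_le_norm_rpow (p := 2) (by norm_num) u t
  simpa using this

theorem sum_sq_sum_norm_hankel_le {a : ℕ → ℂ} {C : ℝ} (ha : ∀ k, ‖a k‖ ≤ C / (k + 1))
    (u : EllTwo) (s t : Finset ℕ) :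
    ∑ n ∈ s, (∑ m ∈ t, ‖a (n + m) * u m‖) ^ 2 ≤ (4 * C * ‖u‖) ^ 2 := by
  calc ∑ n ∈ s, (∑ m ∈ t, ‖a (n + m) * u m‖) ^ 2
      ≤ ∑ n ∈ s, (C * ∑ m ∈ t, ((n : ℝ) + m + 1)⁻¹ * ‖u m‖) ^ 2 := by
        gcongr with n _
        rw [Finset.mul_sum]
        gcongr with m _
        rw [norm_mul, ← mul_assoc]
        gcongr
        refine (ha (n + m)).trans (le_of_eq ?_)
        push_cast
        rw [div_eq_mul_inv]
    _ = C ^ 2 * ∑ n ∈ s, (∑ m ∈ t, ((n : ℝ) + m + 1)⁻¹ * ‖u m‖) ^ 2 := by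
        simp_rw [mul_pow, Finset.mul_sum]
    _ ≤ C ^ 2 * (16 * ‖u‖ ^ 2) := by
        gcongr
        refine (sum_sq_sum_inv_mul_le _ s t).trans ?_
        gcongr
        exact EllTwo.sum_norm_sq_le u t
    _ = (4 * C * ‖u‖) ^ 2 := by ring

theorem summable_norm_hankel {a : ℕ → ℂ} {C : ℝ} (ha : ∀ k, ‖a k‖ ≤ C / (k + 1))
    (u : EllTwo) (n : ℕ) : Summable fun m => ‖a (n + m) * u m‖ := by
  refine summable_of_sum_le (c := |4 * C * ‖u‖|) (fun _ => norm_nonneg _) fun t => ?_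
  have := sum_sq_sum_norm_hankel_le ha u {n} t
  rw [Finset.sum_singleton] at this
  exact (le_abs_self _).trans (sq_le_sq.1 this)

theorem sum_sq_norm_tsum_hankel_le {a : ℕ → ℂ} {C : ℝ} (ha : ∀ k, ‖a k‖ ≤ C / (k + 1))
    (u : EllTwo) (s : Finset ℕ) :
    ∑ n ∈ s, ‖∑' m, a (n + m) * u m‖ ^ 2 ≤ (4 * C * ‖u‖) ^ 2 := by
  have h1 : Filter.Tendsto (fun t : Finset ℕ => ∑ n ∈ s, (∑ m ∈ t, ‖a (n + m) * u m‖) ^ 2)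
      Filter.atTop (nhds (∑ n ∈ s, (∑' m, ‖a (n + m) * u m‖) ^ 2)) :=
    tendsto_finsetSum _ fun n _ => ((summable_norm_hankel ha u n).hasSum).pow 2
  refine le_trans ?_ (le_of_tendsto' h1 (sum_sq_sum_norm_hankel_le ha u s))
  gcongr with n _
  exact norm_tsum_le_tsum_norm (summable_norm_hankel ha u n)

/-- The entries are dominated by C times the Hilbert matrix, whose norm the Schur test bounds by 4.
-/
theorem exists_isHankel {a : ℕ → ℂ} {C : ℝ} (ha : ∀ k, ‖a k‖ ≤ C / (k + 1)) :
    ∃ G : EllTwo →L[ℂ] EllTwo, IsHankel a G := by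
  have hC : 0 ≤ C := by
    have := (norm_nonneg _).trans (ha 0)
    simpa using this
  have hmem : ∀ u : EllTwo, Memℓp (fun n => ∑' m, a (n + m) * u m) 2 := fun u =>
    memℓp_gen' (C := (4 * C * ‖u‖) ^ 2) fun s => by
      simpa using sum_sq_norm_tsum_hankel_le ha u s
  let G : EllTwo →ₗ[ℂ] EllTwo :=
    { toFun := fun u => ⟨fun n => ∑' m, a (n + m) * u m, hmem u⟩
      map_add' := fun u v => by
        ext n
        change ∑' m, a (n + m) * (u m + v m) = ∑' m, a (n + m) * u m + ∑' m, a (n + m) * v m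
        rw [← (summable_norm_hankel ha u n).of_norm.tsum_add (summable_norm_hankel ha v n).of_norm]
        simp_rw [mul_add]
      map_smul' := fun c u => by
        ext n
        change ∑' m, a (n + m) * (c * u m) = c * ∑' m, a (n + m) * u m
        rw [← tsum_mul_left]
        refine tsum_congr fun m => by ring }
  refine ⟨G.mkContinuous (4 * C) fun u => ?_, fun n m => ?_⟩
  · refine lp.norm_le_of_forall_sum_le (by norm_num) (by positivity) fun s => ?_
    have h : ∑ n ∈ s, ‖G u n‖ ^ 2 ≤ (4 * C * ‖u‖) ^ 2 := sum_sq_norm_tsum_hankel_le ha u s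
    simpa using h
  · change ∑' k, a (n + k) * (lp.single 2 m (1 : ℂ) : EllTwo) k = a (n + m)
    rw [tsum_eq_single m]
    · simp
    · intro k hk
      rw [lp.single_apply_ne 2 m _ hk, mul_zero]

/-- The finitely supported sequence of the coefficients of a polynomial. -/
noncomputable def coeffVec : ℂ[X] →ₗ[ℂ] EllTwo :=
  Polynomial.lsum fun n => LinearMap.toSpanSingleton ℂ EllTwo (lp.single 2 n (1 : ℂ))

/-- The linear functional on polynomials with moments `a`. -/
noncomputable def momentFunctional (a : ℕ → ℂ) : ℂ[X] →ₗ[ℂ] ℂ :=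
  Polynomial.lsum fun n => LinearMap.toSpanSingleton ℂ ℂ (a n)

theorem coeffVec_monomial (n : ℕ) (c : ℂ) :
    coeffVec (monomial n c) = c • (lp.single 2 n (1 : ℂ) : EllTwo) := by
  simp [coeffVec, Polynomial.lsum_apply, Polynomial.sum_monomial_index]

theorem momentFunctional_monomial (a : ℕ → ℂ) (n : ℕ) (c : ℂ) :
    momentFunctional a (monomial n c) = c * a n := by
  simp [momentFunctional, Polynomial.lsum_apply, Polynomial.sum_monomial_index]

theorem denseRange_coeffVec : DenseRange coeffVec := by
  intro u
  have h := lp.hasSum_single (p := 2) (by norm_num) u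
  refine mem_closure_of_tendsto h (Filter.Eventually.of_forall fun s => ?_)
  refine ⟨∑ i ∈ s, monomial i (u i), ?_⟩
  rw [map_sum]
  refine Finset.sum_congr rfl fun i _ => ?_
  rw [coeffVec_monomial, ← lp.single_smul, smul_eq_mul, mul_one]

open scoped ComplexInnerProductSpace ComplexConjugate

theorem momentFunctional_map_conj {a : ℕ → ℂ} (ha : ∀ n, conj (a n) = a n) (p : ℂ[X]) :
    momentFunctional a (p.map (starRingEnd ℂ)) = conj (momentFunctional a p) := by
  induction p using Polynomial.induction_on' with
  | add p q hp hq => simp [hp, hq]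
  | monomial n c => simp [momentFunctional_monomial, ha]

/-- Entries depending only on n + m make the form factor through the product of polynomials. -/
theorem IsHankel.inner_coeffVec {a : ℕ → ℂ} {G : EllTwo →L[ℂ] EllTwo} (hG : IsHankel a G)
    (r p : ℂ[X]) :
    ⟪coeffVec r, G (coeffVec p)⟫ = momentFunctional a (p * r.map (starRingEnd ℂ)) := by
  induction r using Polynomial.induction_on' with
  | add r r' hr hr' => simp [mul_add, hr, hr']
  | monomial n c =>
    induction p using Polynomial.induction_on' with
    | add p p' hp hp' => rw [map_add, map_add, inner_add_right, add_mul, map_add, hp, hp']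
    | monomial m d =>
      rw [coeffVec_monomial, coeffVec_monomial, map_smul, inner_smul_left, inner_smul_right,
        lp.inner_single_left, hG, map_monomial, monomial_mul_monomial, momentFunctional_monomial,
        add_comm n m]
      simp
      ring

theorem IsHankel.isSelfAdjoint {a : ℕ → ℂ} {G : EllTwo →L[ℂ] EllTwo} (hG : IsHankel a G)
    (ha : ∀ n, conj (a n) = a n) : IsSelfAdjoint G := by
  rw [ContinuousLinearMap.isSelfAdjoint_iff_isSymmetric]
  intro x y
  refine denseRange_coeffVec.induction_on₂ (p := fun x y => ⟪G x, y⟫ = ⟪x, G y⟫)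
    (isClosed_eq (by fun_prop) (by fun_prop)) (fun p r => ?_) x y
  rw [← inner_conj_symm, hG.inner_coeffVec, hG.inner_coeffVec, ← momentFunctional_map_conj ha,
    Polynomial.map_mul, Polynomial.map_map, mul_comm]
  congr 2
  have : (starRingEnd ℂ).comp (starRingEnd ℂ) = RingHom.id ℂ := by ext; simp
  rw [this, Polynomial.map_id]

theorem IsHankel.re_inner_coeffVec {a : ℕ → ℂ} {G : EllTwo →L[ℂ] EllTwo} (hG : IsHankel a G)
    (p : ℂ[X]) : (⟪G (coeffVec p), coeffVec p⟫).re =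
      (momentFunctional a (p * p.map (starRingEnd ℂ))).re := by
  rw [← hG.inner_coeffVec]
  exact inner_re_symm (𝕜 := ℂ) _ _

end HankelOperator

/-! ### Functionals on jets and their negative index -/

open scoped ComplexConjugate

/-- The coefficientwise complex conjugate of a polynomial. -/
noncomputable abbrev conjPoly (p : ℂ[X]) : ℂ[X] := p.map (starRingEnd ℂ)

theorem conjPoly_conjPoly (p : ℂ[X]) : conjPoly (conjPoly p) = p := by
  have : (starRingEnd ℂ).comp (starRingEnd ℂ) = RingHom.id ℂ := by ext; simp
  rw [conjPoly, Polynomial.map_map, this, Polynomial.map_id]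

/-- A family of linear functionals on polynomials, the `j`-th one depending only on the jet of
order `k j` at the point `z j`, with leading coefficient `c j ≠ 0`. The points are distinct. -/
structure LocalFunctionals (ι : Type*) where
  z : ι → ℂ
  inj : Function.Injective z
  k : ι → ℕ
  c : ι → ℂ
  c_ne : ∀ j, c j ≠ 0
  Λ : ι → ℂ[X] →ₗ[ℂ] ℂ
  map_pow_mul : ∀ j g, Λ j ((X - C (z j)) ^ k j * g) = c j * g.eval (z j)

namespace LocalFunctionals

variable {ι : Type*} [Fintype ι] (D : LocalFunctionals ι)

noncomputable def total : ℂ[X] →ₗ[ℂ] ℂ := ∑ j, D.Λ j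

noncomputable def prodPow (e : ι → ℕ) : ℂ[X] := ∏ j, (X - C (D.z j)) ^ e j

/-- The monic generator of the annihilator of `D.total`. -/
noncomputable def modulus : ℂ[X] := D.prodPow fun j => D.k j + 1

theorem total_apply (p : ℂ[X]) : D.total p = ∑ j, D.Λ j p := by simp [total]

omit [Fintype ι] in
theorem map_eq_zero_of_dvd {j : ι} {p : ℂ[X]} (h : (X - C (D.z j)) ^ (D.k j + 1) ∣ p) :
    D.Λ j p = 0 := by
  obtain ⟨g, rfl⟩ := h
  rw [pow_succ, mul_assoc, D.map_pow_mul]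
  simp

theorem prodPow_monic (e : ι → ℕ) : (D.prodPow e).Monic :=
  monic_prod_of_monic _ _ fun _ _ => (monic_X_sub_C _).pow _

theorem natDegree_prodPow (e : ι → ℕ) : (D.prodPow e).natDegree = ∑ j, e j := by
  rw [prodPow, natDegree_prod_of_monic _ _ fun _ _ => (monic_X_sub_C _).pow _]
  simp

theorem pow_dvd_prodPow (e : ι → ℕ) (j : ι) : (X - C (D.z j)) ^ e j ∣ D.prodPow e :=
  Finset.dvd_prod_of_mem _ (Finset.mem_univ j)

theorem total_modulus_mul (g : ℂ[X]) : D.total (D.modulus * g) = 0 := by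
  rw [total_apply]
  exact Finset.sum_eq_zero fun j _ => D.map_eq_zero_of_dvd
    (dvd_mul_of_dvd_left (D.pow_dvd_prodPow (fun j => D.k j + 1) j) _)

/-- Nondegeneracy. If `w` vanishes at z_j only to order i ≤ k_j, the test polynomial (X - z_j)^(k_j
- i) ∏_{l≠j} (X - z_l)^(k_l+1) kills all other functionals and leaves c_j times a nonzero value. -/
theorem modulus_dvd_of_forall_total_eq_zero {w : ℂ[X]} (h : ∀ y, D.total (w * y) = 0) :
    D.modulus ∣ w := by
  classical
  refine Finset.prod_dvd_of_coprime (fun i _ j _ hij =>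
    ((pairwise_coprime_X_sub_C D.inj hij).pow)) fun j _ => ?_
  by_contra hnd
  have hw : w ≠ 0 := by
    rintro rfl
    exact hnd (dvd_zero _)
  obtain ⟨w', hww, hw'⟩ := exists_eq_pow_rootMultiplicity_mul_and_not_dvd w hw (D.z j)
  set i := rootMultiplicity (D.z j) w
  have hi : i ≤ D.k j := by
    by_contra! hlt
    exact hnd ((le_rootMultiplicity_iff hw).1 hlt)
  set g : ℂ[X] := ∏ l ∈ Finset.univ.erase j, (X - C (D.z l)) ^ (D.k l + 1)
  have h1 := h ((X - C (D.z j)) ^ (D.k j - i) * g)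
  rw [total_apply, ← Finset.add_sum_erase _ _ (Finset.mem_univ j)] at h1
  have h2 : w * ((X - C (D.z j)) ^ (D.k j - i) * g) = (X - C (D.z j)) ^ D.k j * (w' * g) := by
    conv_lhs => rw [hww]
    conv_rhs => rw [← Nat.add_sub_cancel' hi, pow_add]
    ring
  rw [Finset.sum_eq_zero, add_zero, h2, D.map_pow_mul, eval_mul] at h1
  · rcases mul_eq_zero.1 h1 with h3 | h3
    · exact D.c_ne j h3
    rcases mul_eq_zero.1 h3 with h3 | h3
    · exact hw' (dvd_iff_isRoot.2 h3)
    · rw [eval_prod] at h3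
      obtain ⟨l, hl, h4⟩ := Finset.prod_eq_zero_iff.1 h3
      rw [eval_pow, eval_sub, eval_X, eval_C] at h4
      have h5 := sub_eq_zero.1 (pow_eq_zero_iff (by omega) |>.1 h4)
      exact (Finset.mem_erase.1 hl).1 (D.inj h5.symm)
  · intro l hl
    refine D.map_eq_zero_of_dvd (dvd_mul_of_dvd_right (dvd_mul_of_dvd_right ?_ _) _)
    exact Finset.dvd_prod_of_mem (fun l => (X - C (D.z l)) ^ (D.k l + 1)) hl

def IsReal : Prop := ∀ p, D.total (conjPoly p) = conj (D.total p)

variable {D}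

/-- By reality the conjugate of `modulus` also annihilates, so `modulus` divides it; compare the
multiplicities of the root z_j. -/
theorem IsReal.exists_conj (hD : D.IsReal) (j : ι) :
    ∃ l, D.z l = conj (D.z j) ∧ D.k j ≤ D.k l := by
  classical
  have h1 : D.modulus ∣ conjPoly D.modulus := by
    refine D.modulus_dvd_of_forall_total_eq_zero fun y => ?_
    rw [← conjPoly_conjPoly y, conjPoly, conjPoly, ← Polynomial.map_mul, hD, total_modulus_mul,
      map_zero]
  have h2 : (X - C (D.z j)) ^ (D.k j + 1) ∣ conjPoly D.modulus :=
    (D.pow_dvd_prodPow (fun j => D.k j + 1) j).trans h1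
  have h3 : conjPoly D.modulus = ∏ l, (X - C (conj (D.z l))) ^ (D.k l + 1) := by
    simp [modulus, prodPow, conjPoly, Polynomial.map_prod]
  rw [h3] at h2
  by_cases hex : ∃ l, D.z l = conj (D.z j)
  · obtain ⟨l, hl⟩ := hex
    refine ⟨l, hl, ?_⟩
    have hlj : conj (D.z l) = D.z j := by rw [hl, Complex.conj_conj]
    rw [← Finset.mul_prod_erase _ _ (Finset.mem_univ l), hlj] at h2
    have hco : IsCoprime ((X - C (D.z j)) ^ (D.k j + 1))
        (∏ i ∈ Finset.univ.erase l, (X - C (conj (D.z i))) ^ (D.k i + 1)) := by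
      refine IsCoprime.prod_right fun i hi => IsCoprime.pow ?_
      refine isCoprime_X_sub_C_of_isUnit_sub (sub_ne_zero.2 fun h => ?_).isUnit
      refine (Finset.mem_erase.1 hi).1 (D.inj ?_)
      rw [hl, h, Complex.conj_conj]
    have h4 := natDegree_le_of_dvd (hco.dvd_of_dvd_mul_right h2)
      (pow_ne_zero _ (X_sub_C_ne_zero _))
    simp only [natDegree_pow, natDegree_X_sub_C, mul_one] at h4
    omega
  · exfalso
    have h4 := (dvd_pow_self (X - C (D.z j)) (Nat.succ_ne_zero (D.k j))).trans h2
    rw [dvd_iff_isRoot, IsRoot, eval_prod] at h4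
    obtain ⟨l, -, h5⟩ := Finset.prod_eq_zero_iff.1 h4
    rw [eval_pow, eval_sub, eval_X, eval_C] at h5
    have h6 := sub_eq_zero.1 (pow_eq_zero_iff (by omega) |>.1 h5)
    exact hex ⟨l, by rw [h6, Complex.conj_conj]⟩

theorem conjPoly_X_sub_C_pow (z : ℂ) (n : ℕ) :
    conjPoly ((X - C z) ^ n) = (X - C (conj z)) ^ n := by
  simp [conjPoly]

theorem conjPoly_dvd {p q : ℂ[X]} (h : p ∣ q) : conjPoly p ∣ conjPoly q := by
  obtain ⟨r, rfl⟩ := h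
  exact ⟨conjPoly r, by simp [conjPoly]⟩

omit [Fintype ι] in
theorem re_apply_mul_conjPoly_nonneg {j : ι} (hz : (D.z j).im = 0) {e : ℕ} (hk : D.k j = 2 * e)
    (hc : 0 ≤ (D.c j).re) {p : ℂ[X]} (hp : (X - C (D.z j)) ^ e ∣ p) :
    0 ≤ (D.Λ j (p * conjPoly p)).re := by
  obtain ⟨h, rfl⟩ := hp
  have hz' : conj (D.z j) = D.z j := Complex.conj_eq_iff_im.2 hz
  have h1 : (X - C (D.z j)) ^ e * h * conjPoly ((X - C (D.z j)) ^ e * h) =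
      (X - C (D.z j)) ^ D.k j * (h * conjPoly h) := by
    rw [conjPoly, Polynomial.map_mul, ← conjPoly, conjPoly_X_sub_C_pow, hz', hk, two_mul, pow_add]
    ring
  have h2 : (conjPoly h).eval (D.z j) = conj (h.eval (D.z j)) := by
    conv_lhs => rw [← hz']
    exact Polynomial.eval_map_apply _ _
  rw [h1, D.map_pow_mul, eval_mul, h2, Complex.mul_conj, Complex.re_mul_ofReal]
  exact mul_nonneg hc (Complex.normSq_nonneg _)

/-- Exponents that make the form `total (p * conjPoly p)` nonnegative on multiples of the
corresponding product. -/
structure IsNonnegExponent (D : LocalFunctionals ι) (e : ι → ℕ) : Prop where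
  real : ∀ j, (D.z j).im = 0 → D.k j + 1 ≤ 2 * e j ∨ (D.k j = 2 * e j ∧ 0 ≤ (D.c j).re)
  nonreal : ∀ j l, (D.z j).im ≠ 0 → D.z l = conj (D.z j) → D.k j ≤ D.k l → D.k j + 1 ≤ e j + e l

/-- If z_l is the conjugate of z_j, then `p * conjPoly p` vanishes at z_j to order e_j + e_l, which
kills the functional once it exceeds k_j. The only survivors are real points with k_j = 2e_j, which
give c_j|h(z_j)|². -/
theorem IsReal.re_total_mul_conjPoly_nonneg (hD : D.IsReal) {e : ι → ℕ}
    (he : D.IsNonnegExponent e) {p : ℂ[X]} (hp : D.prodPow e ∣ p) :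
    0 ≤ (D.total (p * conjPoly p)).re := by
  rw [total_apply, Complex.re_sum]
  refine Finset.sum_nonneg fun j _ => ?_
  have hj : (X - C (D.z j)) ^ e j ∣ p := (D.pow_dvd_prodPow e j).trans hp
  have hkill : ∀ l, D.z l = conj (D.z j) → D.k j + 1 ≤ e j + e l →
      0 ≤ (D.Λ j (p * conjPoly p)).re := by
    intro l hl hle
    rw [D.map_eq_zero_of_dvd, Complex.zero_re]
    refine (pow_dvd_pow _ hle).trans ?_
    rw [pow_add]
    refine mul_dvd_mul hj ?_
    have h1 := conjPoly_dvd ((D.pow_dvd_prodPow e l).trans hp)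
    rwa [conjPoly_X_sub_C_pow, hl, Complex.conj_conj] at h1
  by_cases hz : (D.z j).im = 0
  · rcases he.real j hz with h | ⟨h1, h2⟩
    · exact hkill j (Complex.conj_eq_iff_im.2 hz).symm (by omega)
    · exact re_apply_mul_conjPoly_nonneg hz h1 h2 hj
  · obtain ⟨l, hl, hkl⟩ := hD.exists_conj j
    exact hkill l hl (he.nonreal j l hz hl hkl)

variable (D)

/-- The family of the opposite functionals. -/
noncomputable def neg : LocalFunctionals ι where
  z := D.z
  inj := D.inj
  k := D.k
  c := -D.c
  c_ne := fun j => neg_ne_zero.2 (D.c_ne j)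
  Λ := -D.Λ
  map_pow_mul := fun j g => by simp [D.map_pow_mul]

theorem total_neg (p : ℂ[X]) : D.neg.total p = -D.total p := by
  simp [total_apply, neg]

/-- The contribution of each point to the number of negative squares. -/
noncomputable def negExponent (j : ι) : ℕ :=
  if (D.z j).im = 0 then negCount (D.k j) (D.c j).re else if 0 < (D.z j).im then D.k j + 1 else 0

theorem negCount_le (k : ℕ) (p : ℝ) : negCount k p ≤ k + 1 := by
  unfold negCount
  split_ifs <;> omega

omit [Fintype ι] in
theorem negExponent_le (j : ι) : D.negExponent j ≤ D.k j + 1 := by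
  unfold negExponent
  split_ifs
  · exact negCount_le _ _
  · exact le_rfl
  · exact Nat.zero_le _

omit [Fintype ι] in
theorem isNonnegExponent_negExponent : D.IsNonnegExponent D.negExponent where
  real j hz := by
    simp only [negExponent, hz, if_true, negCount]
    split_ifs with h1 h2
    · obtain ⟨m, hm⟩ := h1
      omega
    · obtain ⟨m, hm⟩ := Nat.not_odd_iff_even.1 h1
      exact Or.inr ⟨by omega, h2.le⟩
    · omega
  nonreal j l hz hl hkl := by
    have hl0 : (D.z l).im = -(D.z j).im := by rw [hl, Complex.conj_im]
    unfold negExponent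
    rw [if_neg hz, hl0, if_neg (neg_ne_zero.2 hz)]
    rcases lt_or_gt_of_ne hz with h | h
    · rw [if_neg h.not_gt, if_pos (neg_pos.2 h)]
      omega
    · rw [if_pos h]
      omega

omit [Fintype ι] in
-- Changing the sign swaps k/2 and k/2 + 1 at real points of even order, keeps (k+1)/2 for odd
-- order, and moves the full multiplicity of a conjugate pair to the lower half-plane.
theorem isNonnegExponent_neg : D.neg.IsNonnegExponent fun j => D.k j + 1 - D.negExponent j where
  real j hz := by
    have hz' : (D.z j).im = 0 := hz
    change D.k j + 1 ≤ 2 * _ ∨ (D.k j = 2 * _ ∧ 0 ≤ (-D.c j).re)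
    simp only [negExponent, hz', if_true, negCount]
    split_ifs with h1 h2
    · obtain ⟨m, hm⟩ := h1
      omega
    · obtain ⟨m, hm⟩ := Nat.not_odd_iff_even.1 h1
      omega
    · obtain ⟨m, hm⟩ := Nat.not_odd_iff_even.1 h1
      refine Or.inr ⟨by omega, ?_⟩
      rw [Complex.neg_re]
      linarith
  nonreal j l hz hl hkl := by
    change D.k j + 1 ≤ _
    change (D.z j).im ≠ 0 at hz
    change D.z l = conj (D.z j) at hl
    change D.k j ≤ D.k l at hkl
    have hl0 : (D.z l).im = -(D.z j).im := by rw [hl, Complex.conj_im]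
    unfold negExponent
    simp only [if_neg hz, hl0, if_neg (neg_ne_zero.2 hz)]
    rcases lt_or_gt_of_ne hz with h | h
    · rw [if_neg h.not_gt]
      omega
    · rw [if_neg (by linarith : ¬ 0 < -(D.z j).im)]
      omega

variable {D}

theorem IsReal.re_total_nonneg (hD : D.IsReal) {p : ℂ[X]} (hp : D.prodPow D.negExponent ∣ p) :
    0 ≤ (D.total (p * conjPoly p)).re :=
  hD.re_total_mul_conjPoly_nonneg D.isNonnegExponent_negExponent hp

theorem IsReal.re_total_nonpos (hD : D.IsReal) {p : ℂ[X]}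
    (hp : D.prodPow (fun j => D.k j + 1 - D.negExponent j) ∣ p) :
    (D.total (p * conjPoly p)).re ≤ 0 := by
  have hD' : D.neg.IsReal := fun q => by rw [total_neg, total_neg, hD, map_neg]
  have := hD'.re_total_mul_conjPoly_nonneg D.isNonnegExponent_neg hp
  rw [total_neg, Complex.neg_re] at this
  linarith

theorem modulus_eq_mul : D.modulus =
    D.prodPow D.negExponent * D.prodPow (fun j => D.k j + 1 - D.negExponent j) := by
  simp only [modulus, prodPow, ← Finset.prod_mul_distrib, ← pow_add]
  refine Finset.prod_congr rfl fun j _ => ?_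
  rw [Nat.add_sub_cancel' (D.negExponent_le j)]

/-- The vectors `prodPow * X ^ i` with `i < N` have a dual family for `total (p * q)`. -/
theorem exists_dual_family {N : ℕ} (hN : ∑ j, D.negExponent j = N) (i : Fin N) :
    ∃ y, ∀ l : Fin N,
      D.total (D.prodPow (fun j => D.k j + 1 - D.negExponent j) * X ^ (l : ℕ) * y) =
      if l = i then 1 else 0 := by
  set w := D.prodPow (fun j => D.k j + 1 - D.negExponent j) with hw
  let Φ : ℂ[X] →ₗ[ℂ] (Fin N → ℂ) :=
    LinearMap.pi fun l => D.total ∘ₗ LinearMap.mulLeft ℂ (w * X ^ (l : ℕ))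
  have hsurj : LinearMap.range Φ = ⊤ := by
    by_contra hne
    -- A functional vanishing on the range yields `s` of degree < N with `w * s` annihilating. Then
    -- `modulus` divides `w * s`, so a polynomial of degree N divides `s`, and `s = 0`.
    obtain ⟨f, hf0, hf⟩ := Submodule.exists_le_ker_of_lt_top _ (lt_top_iff_ne_top.2 hne)
    set s : ℂ[X] := ∑ l : Fin N, C (f (Pi.single l 1)) * X ^ (l : ℕ) with hs
    have h1 : ∀ y, D.total (w * s * y) = 0 := by
      intro y
      have h2 : f (Φ y) = 0 := hf ⟨y, rfl⟩
      have h3 : Φ y = ∑ l, Φ y l • (Pi.single l 1 : Fin N → ℂ) := by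
        ext m
        simp [Finset.sum_apply, Pi.single_apply]
      rw [h3, map_sum] at h2
      rw [← h2, hs, Finset.mul_sum, Finset.sum_mul, map_sum]
      refine Finset.sum_congr rfl fun l _ => ?_
      have h4 : w * (C (f (Pi.single l 1)) * X ^ (l : ℕ)) * y =
          f (Pi.single l 1) • (w * X ^ (l : ℕ) * y) := by
        rw [smul_eq_C_mul]
        ring
      rw [map_smul, h4, map_smul, smul_eq_mul, smul_eq_mul, mul_comm]
      rfl
    have h2 := D.modulus_dvd_of_forall_total_eq_zero h1
    rw [modulus_eq_mul, ← hw, mul_comm] at h2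
    have h3 : D.prodPow D.negExponent ∣ s :=
      (mul_dvd_mul_iff_left (D.prodPow_monic _).ne_zero).1 h2
    have hdeg : s.degree < N := by
      refine (degree_sum_le _ _).trans_lt ((Finset.sup_lt_iff (WithBot.bot_lt_coe N)).2 ?_)
      intro l _
      exact (degree_C_mul_X_pow_le _ _).trans_lt (WithBot.coe_lt_coe.2 l.2)
    have hs0 : s = 0 := by
      refine eq_zero_of_dvd_of_degree_lt h3 (hdeg.trans_le ?_)
      rw [degree_eq_natDegree (D.prodPow_monic _).ne_zero, natDegree_prodPow, hN]
    apply hf0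
    apply LinearMap.pi_ext'
    intro l
    ext
    have h5 : s.coeff l = f (Pi.single l 1) := by
      rw [hs, finsetSum_coeff, Finset.sum_eq_single l]
      · simp
      · intro m _ hm
        rw [coeff_C_mul, coeff_X_pow, if_neg (fun h => hm (Fin.ext h.symm)), mul_zero]
      · simp
    rw [hs0, coeff_zero] at h5
    simpa using h5.symm
  obtain ⟨y, hy⟩ := LinearMap.range_eq_top.1 hsurj (Pi.single i 1)
  refine ⟨y, fun l => ?_⟩
  have := congrFun hy l
  rw [Pi.single_apply] at this
  exact this

end LocalFunctionals

/-! ### Density of polynomial multiples in L²(-1, 1) -/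

open scoped ComplexConjugate

/-- The squared `L²(-1, 1)` norm of a polynomial. -/
noncomputable def energy (p : ℂ[X]) : ℝ := ∫ t in (-1 : ℝ)..1, ‖p.eval (t : ℂ)‖ ^ 2

theorem continuous_eval_ofReal (p : ℂ[X]) : Continuous fun t : ℝ => p.eval (t : ℂ) :=
  p.continuous.comp Complex.continuous_ofReal

theorem energy_nonneg (p : ℂ[X]) : 0 ≤ energy p :=
  intervalIntegral.integral_nonneg (by norm_num) fun _ _ => by positivity

theorem energy_sum_smul_le {N : ℕ} (c : Fin N → ℂ) (s : Fin N → ℂ[X]) :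
    energy (∑ i, c i • s i) ≤ (∑ i, ‖c i‖ ^ 2) * ∑ i, energy (s i) := by
  have hs : ∀ i, Continuous fun t : ℝ => (s i).eval (t : ℂ) := fun i => continuous_eval_ofReal _
  have hsum : ∑ i, energy (s i) = ∫ t in (-1 : ℝ)..1, ∑ i, ‖(s i).eval (t : ℂ)‖ ^ 2 :=
    (intervalIntegral.integral_finsetSum fun i _ =>
      ((hs i).norm.pow 2).intervalIntegrable _ _).symm
  rw [hsum, ← intervalIntegral.integral_const_mul]
  unfold energy
  refine intervalIntegral.integral_mono_on (by norm_num)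
    (((continuous_eval_ofReal _).norm.pow 2).intervalIntegrable _ _)
    ((by fun_prop : Continuous _).intervalIntegrable _ _) fun t _ => ?_
  rw [eval_finsetSum]
  have h1 : ‖∑ i, (c i • s i).eval (t : ℂ)‖ ≤ ∑ i, ‖c i‖ * ‖(s i).eval (t : ℂ)‖ := by
    refine (norm_sum_le _ _).trans (le_of_eq ?_)
    simp
  exact (pow_le_pow_left₀ (norm_nonneg _) h1 2).trans (Finset.sum_mul_sq_le_sq_mul_sq _ _ _)

/-- Complex Weierstrass approximation on `[-1, 1]`. -/
theorem exists_polynomial_norm_sub_lt {f : ℝ → ℂ} (hf : Continuous f) {ε : ℝ} (hε : 0 < ε) :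
    ∃ r : ℂ[X], ∀ t ∈ Set.Icc (-1 : ℝ) 1, ‖r.eval (t : ℂ) - f t‖ < ε := by
  obtain ⟨p, hp⟩ := exists_polynomial_near_of_continuousOn (-1) 1 (fun t => (f t).re)
    (by fun_prop) (ε / 2) (half_pos hε)
  obtain ⟨q, hq⟩ := exists_polynomial_near_of_continuousOn (-1) 1 (fun t => (f t).im)
    (by fun_prop) (ε / 2) (half_pos hε)
  refine ⟨p.map Complex.ofRealHom + C Complex.I * q.map Complex.ofRealHom, fun t ht => ?_⟩
  have h1 : ∀ p : ℝ[X], (p.map Complex.ofRealHom).eval (t : ℂ) = ((p.eval t : ℝ) : ℂ) := fun p =>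
    Polynomial.eval_map_apply Complex.ofRealHom t
  rw [eval_add, eval_mul, eval_C, h1, h1]
  refine (Complex.norm_le_abs_re_add_abs_im _).trans_lt ?_
  have h2 := hp t ht
  have h3 := hq t ht
  simp only [Complex.sub_re, Complex.add_re, Complex.sub_im, Complex.add_im, Complex.ofReal_re,
    Complex.ofReal_im, Complex.mul_re, Complex.mul_im, Complex.I_re, Complex.I_im, zero_mul,
    one_mul, zero_sub, mul_zero, add_zero, zero_add, neg_zero]
  linarith

/-- The multiples of a nonzero polynomial are dense in `L²(-1, 1)`. -/
theorem exists_energy_sub_mul_lt (p : ℂ[X]) {w : ℂ[X]} (hw : w ≠ 0) {ε : ℝ} (hε : 0 < ε) :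
    ∃ r : ℂ[X], energy (p - w * r) < ε := by
  have hpc := continuous_eval_ofReal p
  have hwc := continuous_eval_ofReal w
  let δ : ℕ → ℝ := fun n => 1 / ((n : ℝ) + 1)
  have hδ : ∀ n, 0 < δ n := fun n => by positivity
  have hden : ∀ n (t : ℝ), 0 < Complex.normSq (w.eval (t : ℂ)) + δ n := fun n t =>
    add_pos_of_nonneg_of_pos (Complex.normSq_nonneg _) (hδ n)
  -- The quotient p/w is regularized as f = p w̄/(|w|² + δ). The error p - wf = pg is dominated by
  -- |p| and tends to 0 off the finite zero set of w.
  let g : ℕ → ℝ → ℝ := fun n t => δ n / (Complex.normSq (w.eval (t : ℂ)) + δ n)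
  have hgc : ∀ n, Continuous (g n) := fun n =>
    continuous_const.div ((Complex.continuous_normSq.comp hwc).add continuous_const)
      fun t => (hden n t).ne'
  have hg1 : ∀ n t, g n t ≤ 1 := fun n t =>
    (div_le_one (hden n t)).2 (le_add_of_nonneg_left (Complex.normSq_nonneg _))
  have hg0 : ∀ n t, 0 ≤ g n t := fun n t => (div_pos (hδ n) (hden n t)).le
  have hlim : Filter.Tendsto (fun n => ∫ t in (-1 : ℝ)..1, ‖p.eval (t : ℂ) * g n t‖ ^ 2)
      Filter.atTop (nhds (∫ _ in (-1 : ℝ)..1, (0 : ℝ))) := by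
    refine intervalIntegral.tendsto_integral_filter_of_dominated_convergence
      (fun t => ‖p.eval (t : ℂ)‖ ^ 2) ?_ ?_ ?_ ?_
    · refine Filter.Eventually.of_forall fun n => Continuous.aestronglyMeasurable ?_
      have := hgc n
      fun_prop
    · refine Filter.Eventually.of_forall fun n => Filter.Eventually.of_forall fun t _ => ?_
      rw [norm_pow, norm_norm, norm_mul, Complex.norm_real, Real.norm_of_nonneg (hg0 n t)]
      exact pow_le_pow_left₀ (mul_nonneg (norm_nonneg _) (hg0 n t))
        (mul_le_of_le_one_right (norm_nonneg (p.eval (t : ℂ))) (hg1 n t)) 2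
    · exact Continuous.intervalIntegrable (by fun_prop) _ _
    · have hfin : {t : ℝ | w.eval (t : ℂ) = 0}.Finite := by
        refine ((w.roots.toFinset.finite_toSet).preimage
          (f := fun t : ℝ => (t : ℂ)) Complex.ofReal_injective.injOn).subset fun t ht => ?_
        simpa [hw] using ht
      filter_upwards [hfin.countable.ae_notMem MeasureTheory.volume] with t ht _
      have hpos : 0 < Complex.normSq (w.eval (t : ℂ)) := Complex.normSq_pos.2 ht
      have hδ0 : Filter.Tendsto δ Filter.atTop (nhds 0) := tendsto_one_div_add_atTop_nhds_zero_nat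
      have h1 : Filter.Tendsto (fun n => g n t) Filter.atTop (nhds 0) := by
        have := hδ0.div (hδ0.const_add (Complex.normSq (w.eval (t : ℂ))))
          (by simpa using hpos.ne')
        rwa [zero_div] at this
      have h2 : Filter.Tendsto (fun n => ((g n t : ℝ) : ℂ)) Filter.atTop (nhds 0) := by
        have := (Complex.continuous_ofReal.tendsto 0).comp h1
        rwa [Complex.ofReal_zero] at this
      simpa using ((h2.const_mul (p.eval (t : ℂ))).norm.pow 2)
  rw [intervalIntegral.integral_zero] at hlim
  obtain ⟨n, hn⟩ := (hlim.eventually (gt_mem_nhds (by positivity : 0 < ε / 4))).exists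
  let f : ℝ → ℂ := fun t =>
    p.eval (t : ℂ) * conj (w.eval (t : ℂ)) / ((Complex.normSq (w.eval (t : ℂ)) + δ n : ℝ) : ℂ)
  have hne : ∀ t : ℝ, ((Complex.normSq (w.eval (t : ℂ)) + δ n : ℝ) : ℂ) ≠ 0 := fun t =>
    Complex.ofReal_ne_zero.2 (hden n t).ne'
  have hf : Continuous f := by
    refine Continuous.div (by fun_prop) ?_ hne
    exact Complex.continuous_ofReal.comp
      ((Complex.continuous_normSq.comp hwc).add continuous_const)
  have hpf : ∀ t : ℝ, p.eval (t : ℂ) - w.eval (t : ℂ) * f t = p.eval (t : ℂ) * g n t := by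
    intro t
    have h1 := Complex.mul_conj (w.eval (t : ℂ))
    have h2 := hne t
    simp only [f, g]
    push_cast at h2 ⊢
    field_simp
    rw [← h1]
    ring
  obtain ⟨M, hM⟩ := (isCompact_Icc (a := (-1 : ℝ)) (b := 1)).exists_bound_of_continuousOn
    hwc.continuousOn
  have hM0 : 0 ≤ M := (norm_nonneg _).trans (hM 0 (by norm_num))
  -- This makes |w(r - f)|² ≤ ε/16 on [-1, 1], so the total energy is below 2·ε/4 + 2·ε/8 < ε.
  set η := √(ε / 16) / (M + 1)
  have hη : 0 < η := by positivity
  obtain ⟨r, hr⟩ := exists_polynomial_norm_sub_lt hf hη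
  refine ⟨r, ?_⟩
  have hbound : ∀ t ∈ Set.Icc (-1 : ℝ) 1, ‖(p - w * r).eval (t : ℂ)‖ ^ 2 ≤
      2 * ‖p.eval (t : ℂ) * g n t‖ ^ 2 + ε / 8 := by
    intro t ht
    have h1 : (p - w * r).eval (t : ℂ) =
        p.eval (t : ℂ) * g n t - w.eval (t : ℂ) * (r.eval (t : ℂ) - f t) := by
      rw [← hpf, eval_sub, eval_mul]
      ring
    have h2 : ‖w.eval (t : ℂ) * (r.eval (t : ℂ) - f t)‖ ≤ √(ε / 16) := by
      rw [norm_mul]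
      calc _ ≤ (M + 1) * η := mul_le_mul ((hM t ht).trans (by linarith)) (hr t ht).le
            (norm_nonneg _) (by linarith)
        _ = _ := by simp only [η]; field_simp
    have h3 : √(ε / 16) ^ 2 = ε / 16 := Real.sq_sqrt (by positivity)
    have h4 := norm_sub_le (p.eval (t : ℂ) * g n t) (w.eval (t : ℂ) * (r.eval (t : ℂ) - f t))
    rw [h1]
    set A := ‖p.eval (t : ℂ) * g n t‖
    set B := ‖w.eval (t : ℂ) * (r.eval (t : ℂ) - f t)‖
    have hA : 0 ≤ A := norm_nonneg _
    have hB : 0 ≤ B := norm_nonneg _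
    have h5 : B ^ 2 ≤ ε / 16 := by rw [← h3]; exact pow_le_pow_left₀ hB h2 2
    have h6 := pow_le_pow_left₀ (norm_nonneg _) h4 2
    nlinarith [sq_nonneg (A - B)]
  have hint : Continuous fun t : ℝ => ‖p.eval (t : ℂ) * g n t‖ ^ 2 := by
    have := hgc n
    fun_prop
  calc energy (p - w * r)
      ≤ ∫ t in (-1 : ℝ)..1, (2 * ‖p.eval (t : ℂ) * g n t‖ ^ 2 + ε / 8) :=
        intervalIntegral.integral_mono_on (by norm_num)
          (((continuous_eval_ofReal _).norm.pow 2).intervalIntegrable _ _)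
          ((by fun_prop : Continuous _).intervalIntegrable _ _) hbound
    _ = 2 * (∫ t in (-1 : ℝ)..1, ‖p.eval (t : ℂ) * g n t‖ ^ 2) + ε / 4 := by
        rw [intervalIntegral.integral_add ((by fun_prop : Continuous _).intervalIntegrable _ _)
          ((by fun_prop : Continuous _).intervalIntegrable _ _),
          intervalIntegral.integral_const_mul, intervalIntegral.integral_const, smul_eq_mul]
        ring
    _ < ε := by linarith

/-! ### A negative subspace that survives the energy -/

open scoped ComplexConjugate

theorem re_sum_sum_le {N : ℕ} (c : Fin N → ℂ) (b : Fin N → Fin N → ℂ) :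
    (∑ i, ∑ j, c i * conj (c j) * b i j).re ≤ (∑ i, ∑ j, ‖b i j‖) * ∑ i, ‖c i‖ ^ 2 := by
  refine (Complex.re_le_norm _).trans ((norm_sum_le _ _).trans ?_)
  rw [Finset.sum_mul]
  refine Finset.sum_le_sum fun i _ => (norm_sum_le _ _).trans ?_
  rw [Finset.sum_mul]
  refine Finset.sum_le_sum fun j _ => ?_
  rw [norm_mul, norm_mul, RCLike.norm_conj, mul_comm]
  refine mul_le_mul_of_nonneg_left ?_ (norm_nonneg _)
  have h1 : ‖c i‖ ^ 2 ≤ ∑ i, ‖c i‖ ^ 2 :=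
    Finset.single_le_sum (f := fun i => ‖c i‖ ^ 2) (fun _ _ => by positivity) (Finset.mem_univ i)
  have h2 : ‖c j‖ ^ 2 ≤ ∑ i, ‖c i‖ ^ 2 :=
    Finset.single_le_sum (f := fun i => ‖c i‖ ^ 2) (fun _ _ => by positivity) (Finset.mem_univ j)
  nlinarith [sq_nonneg (‖c i‖ - ‖c j‖)]

namespace LocalFunctionals

variable {ι : Type*} [Fintype ι] {D : LocalFunctionals ι}

theorem conjPoly_sum_smul {N : ℕ} (c : Fin N → ℂ) (p : Fin N → ℂ[X]) :
    conjPoly (∑ i, c i • p i) = ∑ i, conj (c i) • conjPoly (p i) := by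
  simp [conjPoly, Polynomial.map_sum, Polynomial.map_smul]

theorem total_sum_mul_conjPoly_sum {N : ℕ} (c : Fin N → ℂ) (p r : Fin N → ℂ[X]) :
    D.total ((∑ i, c i • p i) * conjPoly (∑ i, c i • r i)) =
      ∑ i, ∑ j, c i * conj (c j) * D.total (p i * conjPoly (r j)) := by
  rw [conjPoly_sum_smul, Finset.sum_mul_sum, map_sum]
  refine Finset.sum_congr rfl fun i _ => ?_
  rw [map_sum]
  refine Finset.sum_congr rfl fun j _ => ?_
  rw [smul_mul_smul_comm, map_smul, smul_eq_mul]

/-- The form with the moments of `D` is negative, even after adding the `L²(-1, 1)` energy, on a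
space of polynomials whose dimension is the predicted number of negative squares. -/
theorem IsReal.exists_linearMap_neg (hD : D.IsReal) {N : ℕ} (hN : ∑ j, D.negExponent j = N) :
    ∃ f : (Fin N → ℂ) →ₗ[ℂ] ℂ[X], ∀ c, c ≠ 0 →
      energy (f c) + (D.total (f c * conjPoly (f c))).re < 0 := by
  choose y' hy' using fun i => exists_dual_family hN i
  set w₀ := D.prodPow (fun j => D.k j + 1 - D.negExponent j)
  let w : Fin N → ℂ[X] := fun i => w₀ * X ^ (i : ℕ)
  let y : Fin N → ℂ[X] := fun i => conjPoly (y' i)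
  have hwy : ∀ i j, D.total (w i * conjPoly (y j)) = if i = j then 1 else 0 := fun i j => by
    simp only [w, y, conjPoly_conjPoly, hy']
  set K := ∑ i, ∑ j, ‖D.total (y i * conjPoly (y j))‖
  have hK : 0 ≤ K := Finset.sum_nonneg fun _ _ => Finset.sum_nonneg fun _ _ => norm_nonneg _
  set η : ℝ := 1 / (K + 1) with hη
  have hη0 : 0 < η := by positivity
  have hηK : η * K < 1 := by
    rw [hη, one_div, inv_mul_lt_iff₀ (by positivity)]
    linarith
  have hmod : D.modulus ≠ 0 := (D.prodPow_monic _).ne_zero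
  -- The form is ≤ 0 on the span of the `w i` but may degenerate there. Tilting by -η along the dual
  -- `y i` gains 2ηS at a cost of at most η²KS. Subtracting multiples of `modulus` leaves the form
  -- unchanged and brings the energy down to at most ηS; the denominator is N + 1 because N may be
  -- 0.
  choose r hr using fun i => exists_energy_sub_mul_lt (w i - (η : ℂ) • y i) hmod
    (by positivity : 0 < η / (N + 1))
  let s : Fin N → ℂ[X] := fun i => w i - (η : ℂ) • y i - D.modulus * r i
  refine ⟨Fintype.linearCombination ℂ s, fun c hc => ?_⟩
  rw [Fintype.linearCombination_apply]
  set S := ∑ i, ‖c i‖ ^ 2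
  have hS : 0 < S := by
    obtain ⟨i, hi⟩ := Function.ne_iff.1 hc
    exact Finset.sum_pos' (fun _ _ => by positivity)
      ⟨i, Finset.mem_univ i, by have := norm_pos_iff.2 hi; positivity⟩
  have hE : energy (∑ i, c i • s i) ≤ S * η := by
    refine (energy_sum_smul_le c s).trans (mul_le_mul_of_nonneg_left ?_ hS.le)
    refine (Finset.sum_le_sum fun i _ => (hr i).le).trans ?_
    rw [Finset.sum_const, Finset.card_univ, Fintype.card_fin, nsmul_eq_mul]
    rw [mul_div_assoc', div_le_iff₀ (by positivity)]
    nlinarith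
  set W := ∑ i, c i • w i with hW
  set Y := ∑ i, c i • y i with hY
  set R := ∑ i, c i • r i with hR
  have hsum : ∑ i, c i • s i = W - (η : ℂ) • Y - D.modulus * R := by
    simp only [s, hW, hY, hR, smul_sub, Finset.sum_sub_distrib, Finset.smul_sum, Finset.mul_sum,
      mul_smul_comm]
    congr 2
    exact Finset.sum_congr rfl fun i _ => smul_comm _ _ _
  have hconj : ∀ p q, D.total (q * conjPoly p) = conj (D.total (p * conjPoly q)) := by
    intro p q
    have h : conjPoly (p * conjPoly q) = q * conjPoly p := by
      rw [mul_comm q]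
      conv_rhs => rw [← conjPoly_conjPoly q]
      exact Polynomial.map_mul _
    rw [← hD, h]
  have hkill : ∀ p q, D.total ((p - D.modulus * q) * conjPoly (p - D.modulus * q)) =
      D.total (p * conjPoly p) := by
    intro p q
    have h1 : D.total ((p - D.modulus * q) * conjPoly (p - D.modulus * q)) =
        D.total (p * conjPoly (p - D.modulus * q)) := by
      rw [sub_mul, map_sub, mul_assoc, total_modulus_mul, sub_zero]
    rw [h1, hconj, sub_mul, map_sub, mul_assoc, total_modulus_mul, sub_zero, ← hconj]
  have hWY : D.total (W * conjPoly Y) = (S : ℂ) := by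
    rw [hW, hY, total_sum_mul_conjPoly_sum]
    simp only [hwy, mul_ite, mul_one, mul_zero, Finset.sum_ite_eq, Finset.mem_univ, if_true]
    simp only [S, Complex.mul_conj, Complex.normSq_eq_norm_sq, Complex.ofReal_sum]
  have hYW : D.total (Y * conjPoly W) = (S : ℂ) := by
    rw [hconj, hWY, Complex.conj_ofReal]
  have hWW : (D.total (W * conjPoly W)).re ≤ 0 := by
    refine hD.re_total_nonpos ?_
    rw [hW]
    refine Finset.dvd_sum fun i _ => ?_
    rw [smul_eq_C_mul]
    exact dvd_mul_of_dvd_right (dvd_mul_right _ _) _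
  have hYY : (D.total (Y * conjPoly Y)).re ≤ K * S := by
    rw [hY, total_sum_mul_conjPoly_sum]
    exact re_sum_sum_le _ _
  have hform : D.total ((W - (η : ℂ) • Y) * conjPoly (W - (η : ℂ) • Y)) =
      D.total (W * conjPoly W) - (η : ℂ) * S - (η : ℂ) * S +
        ((η ^ 2 : ℝ) : ℂ) * D.total (Y * conjPoly Y) := by
    have h1 : conjPoly (W - (η : ℂ) • Y) = conjPoly W - (η : ℂ) • conjPoly Y := by
      rw [conjPoly, Polynomial.map_sub, Polynomial.map_smul, Complex.conj_ofReal]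
    have h2 : (W - (η : ℂ) • Y) * (conjPoly W - (η : ℂ) • conjPoly Y) =
        W * conjPoly W - (η : ℂ) • (W * conjPoly Y) - (η : ℂ) • (Y * conjPoly W) +
          ((η ^ 2 : ℝ) : ℂ) • (Y * conjPoly Y) := by
      simp only [smul_eq_C_mul, Complex.ofReal_pow, map_pow]
      ring
    rw [h1, h2, map_add, map_sub, map_sub, map_smul, map_smul, map_smul, hWY, hYW]
    simp only [smul_eq_mul]
  have hre : (D.total ((∑ i, c i • s i) * conjPoly (∑ i, c i • s i))).re ≤
      -(2 * η * S) + η ^ 2 * (K * S) := by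
    rw [hsum, hkill, hform]
    simp only [Complex.add_re, Complex.sub_re, Complex.re_ofReal_mul, Complex.ofReal_re]
    have := mul_le_mul_of_nonneg_left hYY (sq_nonneg η)
    linarith
  have hfin : S * η + (-(2 * η * S) + η ^ 2 * (K * S)) < 0 := by
    have : S * η + (-(2 * η * S) + η ^ 2 * (K * S)) = -(S * η * (1 - η * K)) := by ring
    rw [this, neg_lt_zero]
    exact mul_pos (mul_pos hS hη0) (by linarith)
  linarith

end LocalFunctionals

/-! ### Moments of the Carleman and exponential-polynomial sequences -/

open scoped ComplexConjugate ComplexInnerProductSpace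

section Moments

theorem momentFunctional_add (a b : ℕ → ℂ) (p : ℂ[X]) :
    momentFunctional (fun n => a n + b n) p = momentFunctional a p + momentFunctional b p := by
  induction p using Polynomial.induction_on' with
  | add p q hp hq =>
    rw [map_add, map_add, map_add, hp, hq]
    ring
  | monomial n c =>
    simp only [momentFunctional_monomial]
    ring

theorem momentFunctional_sum {ι : Type*} (s : Finset ι) (a : ι → ℕ → ℂ) (p : ℂ[X]) :
    momentFunctional (fun n => ∑ i ∈ s, a i n) p = ∑ i ∈ s, momentFunctional (a i) p := by
  induction p using Polynomial.induction_on' with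
  | add p q hp hq => simp only [map_add, hp, hq, Finset.sum_add_distrib]
  | monomial n c => simp only [momentFunctional_monomial, Finset.mul_sum]

theorem momentFunctional_carlemanSeq (p : ℂ[X]) :
    momentFunctional carlemanSeq p = ∫ t in (-1 : ℝ)..1, p.eval (t : ℂ) := by
  induction p using Polynomial.induction_on' with
  | add p q hp hq =>
    simp only [map_add, hp, hq, eval_add]
    exact (intervalIntegral.integral_add ((continuous_eval_ofReal p).intervalIntegrable _ _)
      ((continuous_eval_ofReal q).intervalIntegrable _ _)).symm
  | monomial n c =>
    simp only [momentFunctional_monomial, eval_monomial]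
    rw [intervalIntegral.integral_const_mul]
    congr 1
    have h : ∀ t : ℝ, (t : ℂ) ^ n = ((t ^ n : ℝ) : ℂ) := fun t => by push_cast; rfl
    simp only [h]
    rw [intervalIntegral.integral_ofReal, integral_pow, carlemanSeq]
    split_ifs with hn
    · rw [(hn.add_one).neg_pow]
      push_cast
      norm_num
    · rw [((Nat.not_even_iff_odd.1 hn).add_one).neg_pow]
      simp

theorem momentFunctional_carlemanSeq_mul_conjPoly (p : ℂ[X]) :
    momentFunctional carlemanSeq (p * conjPoly p) = energy p := by
  rw [momentFunctional_carlemanSeq, energy, ← intervalIntegral.integral_ofReal]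
  refine intervalIntegral.integral_congr fun t _ => ?_
  have h : (conjPoly p).eval (t : ℂ) = conj (p.eval (t : ℂ)) := by
    conv_lhs => rw [← Complex.conj_ofReal t]
    exact Polynomial.eval_map_apply _ _
  simp only [eval_mul]
  rw [h, Complex.mul_conj, Complex.normSq_eq_norm_sq]

theorem momentFunctional_X_pow_mul {τ : ℕ → ℂ} {K : ℕ} (hτ : ∀ n, K < n → τ n = 0) (g : ℂ[X]) :
    momentFunctional τ (X ^ K * g) = τ K * g.eval 0 := by
  induction g using Polynomial.induction_on' with
  | add p q hp hq => rw [mul_add, map_add, hp, hq, eval_add, mul_add]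
  | monomial n c =>
    rw [X_pow_mul_monomial, momentFunctional_monomial, eval_monomial]
    rcases Nat.eq_zero_or_pos n with rfl | hn
    · simp [mul_comm]
    · rw [hτ _ (by omega), zero_pow hn.ne']
      simp

/-- Multiplication by X - q becomes a forward difference of the coefficient f. Iterated K times on a
polynomial of degree K, it leaves the constant K! times the leading coefficient. -/
theorem momentFunctional_X_sub_C_mul (f : ℂ → ℂ) (q : ℂ) (g : ℂ[X]) :
    momentFunctional (fun n => f n * q ^ n) ((X - C q) * g) =
      q * momentFunctional (fun n => fwdDiff 1 f n * q ^ n) g := by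
  induction g using Polynomial.induction_on' with
  | add p r hp hr => rw [mul_add, map_add, hp, hr, map_add, mul_add]
  | monomial n c =>
    rw [sub_mul, map_sub, X_mul_monomial, C_mul_monomial]
    simp only [momentFunctional_monomial, fwdDiff]
    push_cast
    ring

theorem momentFunctional_X_sub_C_pow_mul (f : ℂ → ℂ) (q : ℂ) (k : ℕ) (g : ℂ[X]) :
    momentFunctional (fun n => f n * q ^ n) ((X - C q) ^ k * g) =
      q ^ k * momentFunctional (fun n => (fwdDiff 1)^[k] f n * q ^ n) g := by
  induction k generalizing f with
  | zero => simp
  | succ k ih =>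
    rw [pow_succ', mul_assoc, momentFunctional_X_sub_C_mul, ih, Function.iterate_succ_apply,
      pow_succ', mul_assoc]

theorem momentFunctional_const_mul_pow (t q : ℂ) (g : ℂ[X]) :
    momentFunctional (fun n => t * q ^ n) g = t * g.eval q := by
  induction g using Polynomial.induction_on' with
  | add p r hp hr => rw [map_add, hp, hr, eval_add, mul_add]
  | monomial n c =>
    rw [momentFunctional_monomial, eval_monomial]
    ring

theorem momentFunctional_eval_mul_pow (T : ℂ[X]) {K : ℕ} (hT : T.natDegree = K) (q : ℂ)
    (g : ℂ[X]) : momentFunctional (fun n => T.eval (n : ℂ) * q ^ n) ((X - C q) ^ K * g) =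
      q ^ K * (T.leadingCoeff * K.factorial) * g.eval q := by
  rw [momentFunctional_X_sub_C_pow_mul (fun x => T.eval x)]
  have h := T.fwdDiff_iter_degree_eq_factorial
  rw [hT] at h
  have h2 : ∀ x : ℂ, (fwdDiff 1)^[K] (fun x => T.eval x) x = T.leadingCoeff * K.factorial :=
    fun x => by
      rw [h]
      simp
  simp only [h2]
  rw [momentFunctional_const_mul_pow]
  ring

theorem topDerivative_eq {T : ℂ[X]} {K : ℕ} (hT : T.natDegree = K) :
    topDerivative T K = (T.leadingCoeff * K.factorial).re := by
  rw [topDerivative, ← coeff_zero_eq_eval_zero, coeff_iterate_derivative, zero_add,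
    Nat.descFactorial_self, nsmul_eq_mul, ← hT, mul_comm]
  rfl

/-- The jet coefficient at q is q^K times the top derivative. The sign matters only for even K, when
q^K > 0. -/
theorem negCount_re_pow_mul {q : ℂ} (hq : q.im = 0) (hq0 : q ≠ 0) (K : ℕ) (p : ℂ) :
    negCount K (q ^ K * p).re = negCount K p.re := by
  unfold negCount
  by_cases h1 : Odd K
  · rw [if_pos h1, if_pos h1]
  · have hx : q = (q.re : ℂ) := by
      apply Complex.ext <;> simp [hq]
    have hx0 : q.re ≠ 0 := fun h => hq0 (by rw [hx, h, Complex.ofReal_zero])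
    have hpos : 0 < q.re ^ K := (Nat.not_odd_iff_even.1 h1).pow_pos hx0
    have hre : (q ^ K * p).re = q.re ^ K * p.re := by
      conv_lhs => rw [hx, ← Complex.ofReal_pow, Complex.re_ofReal_mul]
    simp only [hre, mul_pos_iff_of_pos_left hpos]

theorem tendsto_eval_mul_pow (P : ℂ[X]) {q : ℂ} (hq : ‖q‖ < 1) :
    Filter.Tendsto (fun n : ℕ => P.eval (n : ℂ) * q ^ n) Filter.atTop (nhds 0) := by
  induction P using Polynomial.induction_on' with
  | add p r hp hr =>
    have := hp.add hr
    simpa only [eval_add, add_mul, add_zero] using this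
  | monomial j c =>
    have h := tendsto_pow_const_mul_const_pow_of_abs_lt_one j
      (by rwa [abs_of_nonneg (norm_nonneg q)] : |‖q‖| < 1)
    have h2 : Filter.Tendsto (fun n : ℕ => (n : ℂ) ^ j * q ^ n) Filter.atTop (nhds 0) := by
      rw [tendsto_zero_iff_norm_tendsto_zero]
      simpa using h
    have h3 := h2.const_mul c
    simpa only [eval_monomial, mul_assoc, mul_zero] using h3

theorem exists_norm_le_div_of_tendsto {a : ℕ → ℂ}
    (h : Filter.Tendsto (fun n : ℕ => ((n : ℂ) + 1) * a n) Filter.atTop (nhds 0)) :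
    ∃ C : ℝ, ∀ n : ℕ, ‖a n‖ ≤ C / (n + 1) := by
  obtain ⟨C, hC⟩ := (Metric.isBounded_range_of_tendsto _ h).exists_norm_le
  refine ⟨C, fun n => ?_⟩
  have h1 := hC _ ⟨n, rfl⟩
  have h2 : ‖(n : ℂ) + 1‖ = n + 1 := by
    rw [← Nat.cast_succ, Complex.norm_natCast]
    push_cast
    rfl
  rw [norm_mul, h2] at h1
  rw [le_div_iff₀ (by positivity)]
  linarith

theorem norm_carlemanSeq_le (n : ℕ) : ‖carlemanSeq n‖ ≤ 2 / ((n : ℝ) + 1) := by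
  unfold carlemanSeq
  split_ifs
  · rw [norm_div, ← Nat.cast_succ, Complex.norm_natCast]
    simp
  · rw [norm_zero]
    positivity

theorem conj_carlemanSeq (n : ℕ) : conj (carlemanSeq n) = carlemanSeq n := by
  unfold carlemanSeq
  split_ifs
  · rw [map_div₀, Complex.conj_ofNat, map_add, Complex.conj_natCast, map_one]
  · exact map_zero _

end Moments

/-! ### The count for the perturbed Carleman operator -/

theorem sup_map_coeffVec_topologicalClosure {w : ℂ[X]} (hw : w.Monic) :
    ((LinearMap.range (LinearMap.mulLeft ℂ w)).map coeffVec ⊔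
      (degreeLT ℂ w.natDegree).map coeffVec).topologicalClosure = ⊤ := by
  rw [← Submodule.map_sup]
  have : LinearMap.range (LinearMap.mulLeft ℂ w) ⊔ degreeLT ℂ w.natDegree = ⊤ := by
    rw [eq_top_iff]
    intro p _
    rw [← modByMonic_add_div p w]
    refine add_mem (Submodule.mem_sup_right ?_) (Submodule.mem_sup_left ⟨p /ₘ w, rfl⟩)
    rw [mem_degreeLT, ← degree_eq_natDegree hw.ne_zero]
    exact degree_modByMonic_lt p hw
  rw [this, Submodule.map_top]
  exact Submodule.dense_iff_topologicalClosure_eq_top.1 denseRange_coeffVec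

/-- The Carleman operator perturbed by a real family of local functionals. -/
theorem LocalFunctionals.exists_hankel_negativeMultiplicityEq {ι : Type*} [Fintype ι]
    (D : LocalFunctionals ι) {b : ℕ → ℂ} (hb : ∀ p, momentFunctional b p = D.total p)
    (hreal : ∀ n, conj (b n) = b n) {C : ℝ} (hC : ∀ n : ℕ, ‖b n‖ ≤ C / (n + 1)) :
    ∃ G : EllTwo →L[ℂ] EllTwo, IsHankel (fun n => carlemanSeq n + b n) G ∧ IsSelfAdjoint G ∧
      NegativeMultiplicityEq G (∑ j, D.negExponent j) := by
  have hD : D.IsReal := fun p => by rw [← hb, ← hb, conjPoly, momentFunctional_map_conj hreal]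
  obtain ⟨G, hG⟩ := exists_isHankel (a := fun n => carlemanSeq n + b n) (C := 2 + C) fun n => by
    rw [add_div]
    exact (norm_add_le _ _).trans (add_le_add (norm_carlemanSeq_le n) (hC n))
  have hSA : IsSelfAdjoint G := hG.isSelfAdjoint fun n => by
    rw [map_add, conj_carlemanSeq, hreal]
  have hform : ∀ p, (⟪G (coeffVec p), coeffVec p⟫).re =
      energy p + (D.total (p * conjPoly p)).re := fun p => by
    rw [hG.re_inner_coeffVec, momentFunctional_add, momentFunctional_carlemanSeq_mul_conjPoly, hb,
      Complex.add_re, Complex.ofReal_re]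
  refine ⟨G, hG, hSA, ?_⟩
  obtain ⟨f, hf⟩ := hD.exists_linearMap_neg rfl
  have hdeg := D.natDegree_prodPow D.negExponent
  have : FiniteDimensional ℂ (degreeLT ℂ (D.prodPow D.negExponent).natDegree) :=
    Module.Finite.equiv (degreeLTEquiv ℂ _).symm
  -- W consists of the multiples of `prodPow D.negExponent`, and F of the remainders modulo it, so
  -- dim F is at most the sum of the exponents.
  refine negativeMultiplicityEq_of_form hSA _ _ ?_
    (sup_map_coeffVec_topologicalClosure (D.prodPow_monic D.negExponent)) ?_ (coeffVec ∘ₗ f) ?_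
  · refine (Submodule.finrank_map_le _ _).trans ?_
    rw [(degreeLTEquiv ℂ _).finrank_eq, Module.finrank_fin_fun, hdeg]
  · rintro _ ⟨_, ⟨g, rfl⟩, rfl⟩
    rw [hform]
    exact add_nonneg (energy_nonneg _) (hD.re_total_nonneg (dvd_mul_right _ _))
  · intro c hc
    rw [LinearMap.comp_apply, hform]
    exact hf c hc

/-! ### Exponential polynomials as local functionals -/

section ExpPoly

variable {M : ℕ} (T : Fin M → ℂ[X]) (K : Fin M → ℕ) (q : Fin M → ℂ)

/-- The family of functionals with moments `T m (n) * q m ^ n`. -/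
noncomputable def expLocalFunctionals (hT : ∀ m, (T m).degree = (K m : WithBot ℕ))
    (hq : Function.Injective q) (hq0 : ∀ m, q m ≠ 0) : LocalFunctionals (Fin M) where
  z := q
  inj := hq
  k := K
  c := fun m => q m ^ K m * ((T m).leadingCoeff * (K m).factorial)
  c_ne := fun m => by
    have h : T m ≠ 0 := fun h => by simpa [h] using hT m
    exact mul_ne_zero (pow_ne_zero _ (hq0 m)) (mul_ne_zero (leadingCoeff_ne_zero.2 h)
      (Nat.cast_ne_zero.2 (Nat.factorial_ne_zero _)))
  Λ := fun m => momentFunctional fun n => (T m).eval (n : ℂ) * q m ^ n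
  map_pow_mul := fun m g =>
    momentFunctional_eval_mul_pow (T m) (natDegree_eq_of_degree_eq_some (hT m)) (q m) g

/-- The same family with the functional with moments `τ` added, located at `0`. -/
noncomputable def expLocalFunctionalsOption {τ : ℕ → ℂ} {K₁ : ℕ} (hτ : ∀ n, K₁ < n → τ n = 0)
    (hK₁ : τ K₁ ≠ 0) (hT : ∀ m, (T m).degree = (K m : WithBot ℕ))
    (hq : Function.Injective q) (hq0 : ∀ m, q m ≠ 0) : LocalFunctionals (Option (Fin M)) where
  z := fun o => o.elim 0 q
  inj := by
    rintro (_ | m) (_ | l) h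
    · rfl
    · exact absurd h.symm (hq0 l)
    · exact absurd h (hq0 m)
    · exact congrArg some (hq h)
  k := fun o => o.elim K₁ K
  c := fun o => o.elim (τ K₁) (expLocalFunctionals T K q hT hq hq0).c
  c_ne := by
    rintro (_ | m)
    · exact hK₁
    · exact (expLocalFunctionals T K q hT hq hq0).c_ne m
  Λ := fun o => o.elim (momentFunctional τ) (expLocalFunctionals T K q hT hq hq0).Λ
  map_pow_mul := by
    rintro (_ | m) g
    · simpa using momentFunctional_X_pow_mul hτ g
    · exact (expLocalFunctionals T K q hT hq hq0).map_pow_mul m g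

theorem sum_negExponent_expLocalFunctionals (hT : ∀ m, (T m).degree = (K m : WithBot ℕ))
    (hq : Function.Injective q) (hq0 : ∀ m, q m ≠ 0) :
    ∑ m, (expLocalFunctionals T K q hT hq hq0).negExponent m =
      ∑ m with (q m).im = 0, negCount (K m) (topDerivative (T m) (K m)) +
        ∑ m with 0 < (q m).im, K m + Finset.card {m : Fin M | 0 < (q m).im} := by
  classical
  rw [Finset.card_eq_sum_ones, add_assoc, ← Finset.sum_add_distrib, Finset.sum_filter,
    Finset.sum_filter, ← Finset.sum_add_distrib]
  refine Finset.sum_congr rfl fun m _ => ?_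
  set D := expLocalFunctionals T K q hT hq hq0
  by_cases h : (q m).im = 0
  · have h1 : D.negExponent m =
        negCount (K m) (q m ^ K m * ((T m).leadingCoeff * (K m).factorial)).re := if_pos h
    rw [h1, if_pos h, if_neg (by rw [h]; exact lt_irrefl _), negCount_re_pow_mul h (hq0 m),
      topDerivative_eq (natDegree_eq_of_degree_eq_some (hT m)), add_zero]
  · have h1 : D.negExponent m = if 0 < (q m).im then K m + 1 else 0 := if_neg h
    rw [h1, if_neg h, zero_add]

/-- The factor n + 1 is absorbed into the polynomial T_m, and |q_m| < 1 still forces decay. -/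
theorem exists_norm_expPolySeq_le {τ : ℕ → ℂ} {K₁ : ℕ} (hτ : ∀ n, K₁ < n → τ n = 0)
    (hq1 : ∀ m, ‖q m‖ < 1) : ∃ C : ℝ, ∀ n : ℕ, ‖expPolySeq τ T q n‖ ≤ C / (n + 1) := by
  apply exists_norm_le_div_of_tendsto
  have h1 : Filter.Tendsto (fun n : ℕ => ((n : ℂ) + 1) * τ n) Filter.atTop (nhds 0) := by
    refine tendsto_const_nhds.congr' ?_
    filter_upwards [Filter.eventually_gt_atTop K₁] with n hn
    rw [hτ n hn, mul_zero]
  have h2 : Filter.Tendsto (fun n : ℕ => ∑ m, ((X + 1) * T m).eval (n : ℂ) * q m ^ n)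
      Filter.atTop (nhds (∑ _m : Fin M, 0)) :=
    tendsto_finsetSum _ fun m _ => tendsto_eval_mul_pow _ (hq1 m)
  have h3 := h1.add h2
  simp only [Finset.sum_const_zero, add_zero] at h3
  refine h3.congr fun n => ?_
  simp only [expPolySeq, mul_add, Finset.mul_sum, eval_mul, eval_add, eval_X, eval_one, mul_assoc]

end ExpPoly

theorem theorem5p6 {M : ℕ} (τ : ℕ → ℂ) (K₁ : ℕ) (T : Fin M → ℂ[X]) (K : Fin M → ℕ)
    (q : Fin M → ℂ)
    (hτ : ∀ n, K₁ < n → τ n = 0) (hK₁ : τ ≠ 0 → τ K₁ ≠ 0)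
    (hT : ∀ m, (T m).degree = (K m : WithBot ℕ))
    (hq : Function.Injective q) (hq0 : ∀ m, q m ≠ 0) (hq1 : ∀ m, ‖q m‖ < 1)
    (hreal : ∀ n, (starRingEnd ℂ) (expPolySeq τ T q n) = expPolySeq τ T q n) :
    ∃ G : EllTwo →L[ℂ] EllTwo,
      IsHankel (fun n => carlemanSeq n + expPolySeq τ T q n) G ∧
      IsSelfAdjoint G ∧
      NegativeMultiplicityEq G (totalNegCount τ K₁ T K q) := by
  obtain ⟨C, hC⟩ := exists_norm_expPolySeq_le T q hτ hq1
  have hmom : ∀ p, momentFunctional (expPolySeq τ T q) p = momentFunctional τ p +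
      (expLocalFunctionals T K q hT hq hq0).total p := fun p => by
    rw [LocalFunctionals.total_apply]
    exact (momentFunctional_add _ _ p).trans (congrArg _ (momentFunctional_sum _ _ p))
  have hsum := sum_negExponent_expLocalFunctionals T K q hT hq hq0
  -- Local functionals need nonzero leading coefficients, so a vanishing τ is omitted instead of
  -- being placed at the point 0.
  by_cases h0 : τ = 0
  · have hN : totalNegCount τ K₁ T K q =
        ∑ m, (expLocalFunctionals T K q hT hq hq0).negExponent m := by
      rw [hsum, totalNegCount, if_pos h0, zero_add]
    rw [hN]
    refine (expLocalFunctionals T K q hT hq hq0).exists_hankel_negativeMultiplicityEq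
      (fun p => ?_) hreal hC
    have h1 : momentFunctional τ p = 0 := by
      rw [h0]
      have h2 := momentFunctional_const_mul_pow 0 0 p
      simp only [zero_mul] at h2
      exact h2
    rw [hmom, h1, zero_add]
  · have hN : totalNegCount τ K₁ T K q =
        ∑ o, (expLocalFunctionalsOption T K q hτ (hK₁ h0) hT hq hq0).negExponent o := by
      have hnone : (expLocalFunctionalsOption T K q hτ (hK₁ h0) hT hq hq0).negExponent none =
          negCount K₁ (τ K₁).re := if_pos Complex.zero_im
      rw [Fintype.sum_option, hnone, totalNegCount, if_neg h0, add_assoc, add_assoc,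
        ← add_assoc (∑ m with _, _), ← hsum]
      rfl
    rw [hN]
    refine (expLocalFunctionalsOption T K q hτ (hK₁ h0) hT hq
      hq0).exists_hankel_negativeMultiplicityEq (fun p => ?_) hreal hC
    rw [hmom, LocalFunctionals.total_apply, LocalFunctionals.total_apply, Fintype.sum_option]
    rfl
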